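/- Let $1\le k\le p$ and $n\ge1$ be integers, $\lambda>0$ and $\tau\ge1$. For $0\le r\le k$ let $\Theta_0(k,p,r,\lambda,\tau)$ be the set of all $p\times p$ matrices $\Sigma=V\Lambda V'+I_p$, where $V\in\mathbb R^{p\times r}$ has orthonormal columns and at most $k$ nonzero rows, and $\Lambda=\mathrm{diag}(\lambda_1,\dots,\lambda_r)$ with $\lambda/\tau\le\lambda_r\le\cdots\le\lambda_1\le\lambda$; let $\Theta_2(k,p,\lambda,\tau)=\bigcup_{r=0}^k\Theta_0(k,p,r,\lambda,\tau)$. The data matrix $X\in\mathbb R^{n\times p}$ has i.i.d. rows distributed as $N(0,\Sigma)$, and $S=\frac1nX'X$. Let $\|\cdot\|$ denote the spectral norm and $\sigma_l(M)$ the $l$-th largest singular value of $M$. For $D,B\subset[p]$ let $S_{DB}$ be the $|D|\times|B|$ submatrix of $S$ with rows in $D$ and columns in $B$, and let $S_B$ be the $p\times p$ matrix whose $B\times B$ block is $S_{BB}$, whose remaining diagonal entries are $1$, and whose other entries are $0$. For $\gamma_1>0$ and $1\le m\le p$ put $$x_m=\sqrt{\tfrac mn}+\sqrt{\tfrac{\gamma_1}{n}m\log\tfrac{\mathrm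 e p}{m}},\qquad \eta(m,n,p,\gamma_1)=2x_m+x_m^2,$$ and $\eta(0,n,p,\gamma_1)=0$. Let $\mathbb B_k$ be the set of all $B\subset[p]$ with $|B|=k$ such that for all $D\subset[p]\setminus B$ with $|D|\le k$, $$\|S_D-I_p\|\le\eta(|D|,n,p,\gamma_1)\quad\text{and}\quad\|S_{DB}\|\le2\sqrt{\|S_B\|}\,\eta(k,n,p,\gamma_1).$$ If $\mathbb B_k\ne\emptyset$, let $\hat A=\hat A(X)$ be an arbitrary element of $\mathbb B_k$ and define $$\hat r=\hat r(\gamma_1,\gamma_2)=\max\Big\{1\le l\le k:\ \sigma_l(S_{\hat A\hat A})\ge1+\gamma_2\sqrt{\|S_{\hat A}\|}\,\eta(k,n,p,\gamma_1)\Big\},$$ with $\max\emptyset=0$; if $\mathbb B_k=\emptyset$, set $\hat r=0$. Theorem. There is an absolute constant $C>0$ such that for every $\gamma_1\ge10$ there is a constant $c_0\in(0,1)$, depending only on $\gamma_1$, such that for all $\gamma_2\ge8\sqrt{\gamma_1}+34$ and $\tau\ge1$ there is a constant $\beta>0$, depending only on $\gamma_1,\gamma_2,\tau$, with the following property. For all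 integers $n\ge1$ and $1\le k\le p$, all $\lambda$ with $$\frac{\tau k}{n}\log\frac{\mathrm e p}{k}\le c_0\qquad\text{and}\qquad\lambda\ge\beta\sqrt{\frac kn\log\frac{\mathrm e p}{k}},$$ and every choice of the elements $\hat A(X)\in\mathbb B_k$, $$\sup_{\Sigma\in\Theta_2(k,p,\lambda,\tau)}\mathbb P_\Sigma\big(\hat r\ne\mathrm{rank}(\Lambda)\big)\le C\,p^{1-\gamma_1/2}.$$ -/

import Mathlib

namespace SparseSpiked

open MeasureTheory ProbabilityTheory

/-- The spectral (operator `ℓ² → ℓ²`) norm of a real matrix. -/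
noncomputable def specNorm {m n : Type} [Fintype m] [Fintype n] [DecidableEq n]
    (M : Matrix m n ℝ) : ℝ :=
  ‖(Matrix.toEuclideanLin M).toContinuousLinearMap‖

/-- The `l`-th largest singular value of a real matrix, counted from `l = 1`
(Mathlib's sequence of singular values is indexed from `0`). -/
noncomputable def singVal {m n : Type} [Fintype m] [Fintype n] [DecidableEq n]
    (M : Matrix m n ℝ) (l : ℕ) : ℝ :=
  (Matrix.toEuclideanLin M).singularValues (l - 1)

/-- The row support of a matrix. -/
def rowSupport {p r : ℕ} (V : Matrix (Fin p) (Fin r) ℝ) : Set (Fin p) :=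
  {j | V.row j ≠ 0}

/-- `S = V Λ Vᵀ + I` is a spiked covariance matrix, where `V` is `p × r` with orthonormal
columns and `Λ = diag (ℓ₁, …, ℓᵣ)` with `ℓ₁ ≥ ⋯ ≥ ℓᵣ > 0`. -/
structure IsSpiked {p r : ℕ} (V : Matrix (Fin p) (Fin r) ℝ) (ℓ : Fin r → ℝ)
    (S : Matrix (Fin p) (Fin p) ℝ) : Prop where
  orthonormal : V.transpose * V = 1
  antitone : Antitone ℓ
  pos : ∀ i, 0 < ℓ i
  eq : S = V * Matrix.diagonal ℓ * V.transpose + 1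

/-- The parameter space `Θ₀(k, p, r, λ, τ)`. -/
def Theta0 (k p r : ℕ) (lam τ : ℝ) : Set (Matrix (Fin p) (Fin p) ℝ) :=
  {S | ∃ (V : Matrix (Fin p) (Fin r) ℝ) (ℓ : Fin r → ℝ), IsSpiked V ℓ S ∧
    (∀ i, lam / τ ≤ ℓ i ∧ ℓ i ≤ lam) ∧ (rowSupport V).ncard ≤ k}

/-- The parameter space `Θ₂(k, p, λ, τ) = ⋃_{r = 0}^k Θ₀(k, p, r, λ, τ)`. -/
def Theta2 (k p : ℕ) (lam τ : ℝ) : Set (Matrix (Fin p) (Fin p) ℝ) :=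
  ⋃ r ∈ Finset.range (k + 1), Theta0 k p r lam τ

/-- The data: `n` observations (the rows of the data matrix) in `ℝᵖ`. -/
abbrev Data (n p : ℕ) : Type := Fin n → EuclideanSpace ℝ (Fin p)

/-- The law of a data matrix with `n` i.i.d. rows distributed as `N(0, S)`. -/
noncomputable def dataLaw (n : ℕ) {p : ℕ} (S : Matrix (Fin p) (Fin p) ℝ) :
    Measure (Data n p) :=
  Measure.pi fun _ : Fin n => multivariateGaussian 0 S

/-- The sample covariance matrix `n⁻¹ Xᵀ X`. -/
noncomputable def sampleCov {n p : ℕ} (X : Data n p) : Matrix (Fin p) (Fin p) ℝ :=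
  (1 / (n : ℝ)) • ((Matrix.of fun t j => X t j).transpose * Matrix.of fun t j => X t j)

/-- The submatrix `M_{DB}` with rows in `D` and columns in `B`. -/
def block {p : ℕ} (M : Matrix (Fin p) (Fin p) ℝ) (D B : Finset (Fin p)) : Matrix D B ℝ :=
  M.submatrix Subtype.val Subtype.val

/-- The `p × p` matrix `M_B` which has the block `M_{BB}` on `B × B`, ones on the rest of the
diagonal and zeros elsewhere. -/
def padded {p : ℕ} (M : Matrix (Fin p) (Fin p) ℝ) (B : Finset (Fin p)) :
    Matrix (Fin p) (Fin p) ℝ :=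
  Matrix.of fun i j => if i ∈ B ∧ j ∈ B then M i j else if i = j then 1 else 0

/-- The quantity `η(m, n, p, γ₁)`; it equals `0` for `m = 0`. -/
noncomputable def eta (m n p : ℕ) (γ₁ : ℝ) : ℝ :=
  2 * (√((m : ℝ) / n) + √(γ₁ / n * (m * Real.log (Real.exp 1 * p / m)))) +
    (√((m : ℝ) / n) + √(γ₁ / n * (m * Real.log (Real.exp 1 * p / m)))) ^ 2

/-- The family `𝔹ₖ` of candidate supports computed from the data. -/
def suppSets {n p : ℕ} (k : ℕ) (γ₁ : ℝ) (X : Data n p) : Set (Finset (Fin p)) :=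
  {B | B.card = k ∧ ∀ D : Finset (Fin p), D ⊆ Bᶜ → D.card ≤ k →
    specNorm (padded (sampleCov X) D - 1) ≤ eta D.card n p γ₁ ∧
    specNorm (block (sampleCov X) D B) ≤
      2 * √(specNorm (padded (sampleCov X) B)) * eta k n p γ₁}

/-- `sel` picks an element `Â` of `𝔹ₖ` from the data, whenever `𝔹ₖ` is non-empty. -/
def IsSelection {n p : ℕ} (k : ℕ) (γ₁ : ℝ) (sel : Data n p → Finset (Fin p)) : Prop :=
  ∀ X, (suppSets k γ₁ X).Nonempty → sel X ∈ suppSets k γ₁ X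

open Classical in
/-- The rank estimator `r̂`: the largest `l ∈ {1, …, k}` such that the `l`-th singular value of
the block `S_{ÂÂ}` of the sample covariance matrix is at least `1 + γ₂ ‖S_Â‖^{1/2} η(k,n,p,γ₁)`,
and `0` if there is no such `l` or if `𝔹ₖ` is empty. -/
noncomputable def rankEst {n p : ℕ} (k : ℕ) (γ₁ γ₂ : ℝ) (sel : Data n p → Finset (Fin p))
    (X : Data n p) : ℕ :=
  if (suppSets k γ₁ X).Nonempty then
    ((Finset.Icc 1 k).filter fun l =>
      1 + γ₂ * √(specNorm (padded (sampleCov X) (sel X))) * eta k n p γ₁ ≤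
        singVal (block (sampleCov X) (sel X) (sel X)) l).sup id
  else 0

end SparseSpiked

/-! Fix a set `A` of size `k` containing the row support of `V`. On `GoodEvent` the sample
covariance `Ŝ` approximates `S` multiplicatively, `|vᵀŜv - vᵀSv| ≤ δ vᵀSv`, on `ℝ^A` and, for all
`D` off `A` with `|D| ≤ k`, on `ℝ^D` and `ℝ^(A ∪ D)`, where `δ` is respectively `η(k)`, `η(|D|)` and
`9/5 η(k)`. The rest of the argument on this event is deterministic.

Off the support `S` is the identity and has no cross terms with `A`, so `A` passes its own tests and
`𝔹ₖ` is nonempty (`GoodEvent.mem_suppSets`). The selected `B` may differ from `A`. The vectors of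
`ℝ^B` killed by `Vᵀ` have codimension at most `r`, and `S` acts on them as the identity form, so the
singular value of index `r + 1` is at most `1 + 9/5 η` (`GoodEvent.singVal_succ_le`). Conversely,
split a vector of the column space of `V` as `x + y`, with `x` on `B` and `y` on `A \ B`. The tests
passed by `B` with `D = A \ B` say that `y` carries only noise energy and hardly correlates with
`x`; the signal therefore sits in `x`, and Courant-Fischer bounds the `r`-th singular value below
(`GoodEvent.le_singVal`). The threshold falls strictly between the two (`separation_of_signal`,
`GoodEvent.rankEst_eq`).

For the probability, whitening reduces each coordinate subspace to chi-squared Chernoff bounds on a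
net (`dataLaw_real_coordSubspace`). The entropy `m log (e p / m)` inside `η` pays for the net and
for the choice of `D`, leaving `p ^ (1 - γ₁ / 2)` (`dataLaw_real_not_goodEvent_le`). -/

namespace SparseSpiked

open MeasureTheory ProbabilityTheory

/-! ### Chi-squared concentration in one direction -/

section Gaussian

open Matrix

lemma dotProduct_sampleCov_mulVec {n p : ℕ} (X : Data n p) (v w : Fin p → ℝ) :
    v ⬝ᵥ sampleCov X *ᵥ w = (1 / (n : ℝ)) * ∑ t, (v ⬝ᵥ X t) * (w ⬝ᵥ X t) := by
  simp only [sampleCov, smul_mulVec, dotProduct_smul, smul_eq_mul]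
  congr 1
  rw [← mulVec_mulVec, dotProduct_mulVec, vecMul_transpose]
  simp only [dotProduct, mulVec, of_apply]
  refine Finset.sum_congr rfl fun t _ => ?_
  congr 1 <;> exact Finset.sum_congr rfl fun i _ => mul_comm _ _

lemma dotProduct_sampleCov_comm {n p : ℕ} (X : Data n p) (v w : Fin p → ℝ) :
    v ⬝ᵥ sampleCov X *ᵥ w = w ⬝ᵥ sampleCov X *ᵥ v := by
  simp only [dotProduct_sampleCov_mulVec, mul_comm]

lemma map_dotProduct_multivariateGaussian {p : ℕ} {S : Matrix (Fin p) (Fin p) ℝ}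
    (hS : S.PosSemidef) {v : Fin p → ℝ} (hv : v ⬝ᵥ S *ᵥ v = 1) :
    (multivariateGaussian 0 S).map (fun x : EuclideanSpace ℝ (Fin p) => v ⬝ᵥ x) =
      gaussianReal 0 1 := by
  have hL : (fun x : EuclideanSpace ℝ (Fin p) => v ⬝ᵥ x) =
      fun x => innerSL ℝ (WithLp.toLp 2 v) x := by
    ext x
    simp [PiLp.inner_apply, dotProduct, mul_comm]
  rw [hL, IsGaussian.map_eq_gaussianReal, ContinuousLinearMap.integral_comp_id_comm]
  · rw [integral_id_multivariateGaussian, map_zero]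
    congr
    have h2 := covarianceBilin_multivariateGaussian (μ := 0) hS (WithLp.toLp 2 v) (WithLp.toLp 2 v)
    rw [covarianceBilin_self IsGaussian.memLp_two_id] at h2
    rw [show (WithLp.toLp 2 v).ofLp = v from rfl, hv] at h2
    have h3 : Var[⇑(innerSL ℝ (WithLp.toLp 2 v)); multivariateGaussian 0 S] = 1 := h2
    rw [h3]; simp
  · exact IsGaussian.integrable_id

lemma integral_exp_mul_sq_gaussianReal {θ : ℝ} (hθ : θ < 1 / 2) :
    Integrable (fun x => Real.exp (θ * x ^ 2)) (gaussianReal 0 1) ∧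
      ∫ x, Real.exp (θ * x ^ 2) ∂gaussianReal 0 1 = (√(1 - 2 * θ))⁻¹ := by
  have hpdf : ∀ x, gaussianPDFReal 0 1 x • Real.exp (θ * x ^ 2) =
      (√(2 * Real.pi))⁻¹ * Real.exp (-(1 / 2 - θ) * x ^ 2) := by
    intro x
    simp only [gaussianPDFReal, smul_eq_mul, mul_assoc, ← Real.exp_add]
    simp only [NNReal.coe_one, mul_one]
    congr 2
    ring
  have hint : Integrable (fun x => gaussianPDFReal 0 1 x • Real.exp (θ * x ^ 2)) := by
    simp only [hpdf]
    exact (integrable_exp_neg_mul_sq (by linarith)).const_mul _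
  constructor
  · rw [gaussianReal_of_var_ne_zero _ one_ne_zero]
    rw [integrable_withDensity_iff_integrable_smul' (by fun_prop)
      (ae_of_all _ fun x => gaussianPDF_lt_top)]
    simpa only [toReal_gaussianPDF] using hint
  · rw [integral_gaussianReal_eq_integral_smul one_ne_zero]
    simp only [hpdf]
    rw [integral_const_mul, integral_gaussian, ← Real.sqrt_inv, ← Real.sqrt_mul (by positivity),
      ← Real.sqrt_inv]
    congr 1
    have : 1 - 2 * θ ≠ 0 := by linarith
    have : 1 / 2 - θ ≠ 0 := by linarith
    field_simp

/-- Expanding `-log (1 - y) = y + y²/2 + y³/3 + ⋯`, the terms from the cubic on cost at most `y²/30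
+ y²/90`, within the allowed slack `y²/20`. -/
lemma inv_sqrt_one_sub_le {y : ℝ} (hy : |y| ≤ 1 / 10) :
    (√(1 - y))⁻¹ ≤ Real.exp (y / 2 + (11 / 40) * y ^ 2) := by
  have hy' := abs_le.1 hy
  have h1 : 0 < 1 - y := by linarith
  rw [← Real.sqrt_inv, Real.sqrt_le_left (Real.exp_pos _).le, ← Real.exp_nat_mul,
    inv_le_comm₀ h1 (Real.exp_pos _), ← Real.exp_neg]
  have h := Real.abs_log_sub_add_sum_range_le (show |y| < 1 by linarith) 3
  rw [Finset.sum_range_succ, Finset.sum_range_succ, Finset.sum_range_one] at h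
  have h2 := (abs_le.1 h).1
  have h3 : |y| ^ 4 / (1 - |y|) ≤ y ^ 2 / 90 := by
    rw [div_le_iff₀ (by linarith), show |y| ^ 4 = y ^ 2 * y ^ 2 by rw [← sq_abs y]; ring]
    have hy2 : y ^ 2 ≤ 1 / 100 := by rw [← sq_abs]; nlinarith [abs_nonneg y]
    nlinarith [mul_le_mul_of_nonneg_left hy2 (sq_nonneg y),
      mul_le_mul_of_nonneg_left hy (sq_nonneg y)]
  norm_num at h2 h3
  have h4 : -(((2 : ℕ) : ℝ) * (y / 2 + 11 / 40 * y ^ 2)) ≤ Real.log (1 - y) := by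
    push_cast
    nlinarith [mul_nonneg (sq_nonneg y) (show (0 : ℝ) ≤ 1 / 10 - y by linarith)]
  calc _ ≤ Real.exp (Real.log (1 - y)) := Real.exp_le_exp.2 (by linarith)
    _ = _ := Real.exp_log h1

lemma dataLaw_real_exp_sum_sq {n p : ℕ} {S : Matrix (Fin p) (Fin p) ℝ} (hS : S.PosSemidef)
    {v : Fin p → ℝ} (hv : v ⬝ᵥ S *ᵥ v = 1) {θ : ℝ} (hθ : θ < 1 / 2) :
    Integrable (fun X : Data n p => Real.exp (θ * ∑ t, (v ⬝ᵥ X t) ^ 2)) (dataLaw n S) ∧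
      mgf (fun X : Data n p => ∑ t, (v ⬝ᵥ X t) ^ 2) (dataLaw n S) θ = (√(1 - 2 * θ))⁻¹ ^ n := by
  have hmap := map_dotProduct_multivariateGaussian hS hv
  have hmeas : Measurable (fun x : EuclideanSpace ℝ (Fin p) => v ⬝ᵥ x) := by
    unfold dotProduct; fun_prop
  obtain ⟨hi, he⟩ := integral_exp_mul_sq_gaussianReal hθ
  rw [← hmap] at hi he
  rw [integrable_map_measure (by fun_prop) hmeas.aemeasurable] at hi
  rw [integral_map hmeas.aemeasurable (by fun_prop)] at he
  have hprod : (fun X : Data n p => Real.exp (θ * ∑ t, (v ⬝ᵥ X t) ^ 2)) =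
      fun X => ∏ t, Real.exp (θ * (v ⬝ᵥ X t) ^ 2) := by
    ext X
    rw [Finset.mul_sum, Real.exp_sum]
  constructor
  · rw [hprod]
    exact Integrable.fintype_prod (f := fun (_ : Fin n) (x : EuclideanSpace ℝ (Fin p)) =>
      Real.exp (θ * (v ⬝ᵥ x) ^ 2)) fun _ => hi
  · rw [mgf, hprod, dataLaw, integral_fintype_prod_eq_prod
      (f := fun _ (x : EuclideanSpace ℝ (Fin p)) => Real.exp (θ * (v ⬝ᵥ x) ^ 2)), he]
    simp

instance {n p : ℕ} (S : Matrix (Fin p) (Fin p) ℝ) : IsProbabilityMeasure (dataLaw n S) := by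
  unfold dataLaw; infer_instance

/-- Deviation of the sample second moment in a fixed direction of unit variance. -/
lemma dataLaw_real_abs_sub_one_ge {n p : ℕ} (hn : 1 ≤ n) {S : Matrix (Fin p) (Fin p) ℝ}
    (hS : S.PosSemidef) {v : Fin p → ℝ} (hv : v ⬝ᵥ S *ᵥ v = 1) {s : ℝ} (hs0 : 0 < s)
    (hs : s ≤ 1 / 10) :
    (dataLaw n S).real {X | s ≤ |v ⬝ᵥ sampleCov X *ᵥ v - 1|} ≤
      2 * Real.exp (-(n * (9 / 40 * s ^ 2))) := by
  have hn' : (0 : ℝ) < n := by exact_mod_cast hn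
  have key : ∀ X : Data n p, ∑ t, (v ⬝ᵥ X t) ^ 2 = n * (v ⬝ᵥ sampleCov X *ᵥ v) := by
    intro X
    rw [dotProduct_sampleCov_mulVec]
    field_simp
  have hsub : {X : Data n p | s ≤ |v ⬝ᵥ sampleCov X *ᵥ v - 1|} ⊆
      {X | n * (1 + s) ≤ ∑ t, (v ⬝ᵥ X t) ^ 2} ∪ {X | ∑ t, (v ⬝ᵥ X t) ^ 2 ≤ n * (1 - s)} := by
    intro X hX
    simp only [Set.mem_ofPred_eq, Set.mem_union, key] at hX ⊢
    rcases le_abs.1 hX with h | h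
    · left; nlinarith
    · right; nlinarith
  -- The choice `θ = ± s/2` is optimal to first order and leaves the rate `1/2 - 11/40 = 9/40`.
  obtain ⟨hi1, hm1⟩ := dataLaw_real_exp_sum_sq (n := n) hS hv (θ := s / 2) (by linarith)
  obtain ⟨hi2, hm2⟩ := dataLaw_real_exp_sum_sq (n := n) hS hv (θ := -(s / 2)) (by linarith)
  have b1 := measure_ge_le_exp_mul_mgf (n * (1 + s)) (by linarith : (0 : ℝ) ≤ s / 2) hi1
  have b2 := measure_le_le_exp_mul_mgf (n * (1 - s)) (by linarith : -(s / 2) ≤ (0 : ℝ)) hi2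
  rw [hm1] at b1
  rw [hm2] at b2
  have c1 : Real.exp (-(s / 2) * (n * (1 + s))) * (√(1 - 2 * (s / 2)))⁻¹ ^ n ≤
      Real.exp (-(n * (9 / 40 * s ^ 2))) := by
    have h := inv_sqrt_one_sub_le (y := s) (by rw [abs_of_pos hs0]; exact hs)
    calc _ ≤ Real.exp (-(s / 2) * (n * (1 + s))) * Real.exp (s / 2 + (11 / 40) * s ^ 2) ^ n := by
          rw [show 2 * (s / 2) = s by ring]
          gcongr
      _ = _ := by
          rw [← Real.exp_nat_mul, ← Real.exp_add]
          congr 1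
          ring
  have c2 : Real.exp (-(-(s / 2)) * (n * (1 - s))) * (√(1 - 2 * (-(s / 2))))⁻¹ ^ n ≤
      Real.exp (-(n * (9 / 40 * s ^ 2))) := by
    have h := inv_sqrt_one_sub_le (y := -s) (by rw [abs_neg, abs_of_pos hs0]; exact hs)
    calc _ ≤ Real.exp (-(-(s / 2)) * (n * (1 - s))) *
          Real.exp (-s / 2 + (11 / 40) * (-s) ^ 2) ^ n := by
          rw [show 2 * (-(s / 2)) = -s by ring]
          gcongr
      _ = _ := by
          rw [← Real.exp_nat_mul, ← Real.exp_add]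
          congr 1
          ring
  calc _ ≤ _ := measureReal_mono hsub
    _ ≤ _ := measureReal_union_le _ _
    _ ≤ _ := by linarith [b1.trans c1, b2.trans c2]

end Gaussian
end SparseSpiked

namespace SparseSpiked

open MeasureTheory ProbabilityTheory

/-! ### Nets of the unit sphere -/

section Nets

open Module Metric

/-- Volume bound for `ε`-separated subsets of the unit sphere. -/
lemma card_le_of_separated_sphere {E : Type*} [NormedAddCommGroup E] [NormedSpace ℝ E]
    [FiniteDimensional ℝ E] (s : Finset E) (hs : ∀ c ∈ s, ‖c‖ ≤ 1)
    (h : ∀ c ∈ s, ∀ d ∈ s, c ≠ d → 1 / 10 ≤ ‖c - d‖) : s.card ≤ 21 ^ finrank ℝ E := by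
  borelize E
  let μ : Measure E := Measure.addHaar
  -- Balls of half the separation radius are disjoint and lie in the ball of radius `1 + 1/20`; the
  -- ratio of radii is `21`.
  let δ : ℝ := 1 / 20
  let ρ : ℝ := 21 / 20
  have δpos : 0 < δ := by norm_num [δ]
  have ρpos : 0 < ρ := by norm_num [ρ]
  set A := ⋃ c ∈ s, ball (c : E) δ with hA
  have D : Set.Pairwise (s : Set E) (Function.onFun Disjoint fun c => ball (c : E) δ) := by
    rintro c hc d hd hcd
    apply ball_disjoint_ball
    rw [dist_eq_norm]
    refine le_trans ?_ (h c hc d hd hcd)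
    norm_num [δ]
  have A_subset : A ⊆ ball (0 : E) ρ := by
    refine Set.iUnion₂_subset fun x hx => ball_subset_ball' ?_
    rw [dist_zero_right]
    have := hs x hx
    simp only [δ, ρ]
    linarith
  have I : (s.card : ENNReal) * ENNReal.ofReal (δ ^ finrank ℝ E) * μ (ball 0 1) ≤
      ENNReal.ofReal (ρ ^ finrank ℝ E) * μ (ball 0 1) :=
    calc
      (s.card : ENNReal) * ENNReal.ofReal (δ ^ finrank ℝ E) * μ (ball 0 1) = μ A := by
        rw [hA, measure_biUnion_finset D fun c _ => measurableSet_ball]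
        simp only [μ.addHaar_ball_of_pos _ δpos]
        simp only [Finset.sum_const, nsmul_eq_mul, mul_assoc]
      _ ≤ μ (ball (0 : E) ρ) := measure_mono A_subset
      _ = ENNReal.ofReal (ρ ^ finrank ℝ E) * μ (ball 0 1) := by
        simp only [μ.addHaar_ball_of_pos _ ρpos]
  have J : (s.card : ENNReal) * ENNReal.ofReal (δ ^ finrank ℝ E) ≤
      ENNReal.ofReal (ρ ^ finrank ℝ E) :=
    (ENNReal.mul_le_mul_iff_left (measure_ball_pos _ _ zero_lt_one).ne' measure_ball_lt_top.ne).1 I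
  have K : (s.card : ℝ) ≤ (21 : ℝ) ^ finrank ℝ E := by
    have h2 := ENNReal.toReal_le_of_le_ofReal (pow_nonneg ρpos.le _) J
    rw [ENNReal.toReal_mul, ENNReal.toReal_natCast, ENNReal.toReal_ofReal (by positivity),
      ← le_div_iff₀ (by positivity), ← div_pow] at h2
    norm_num [δ, ρ] at h2
    exact h2
  exact mod_cast K

/-- A maximal separated set is a cover; the volume bound makes it finite and controls its size. -/
lemma exists_net_sphere (E : Type*) [NormedAddCommGroup E] [NormedSpace ℝ E]
    [FiniteDimensional ℝ E] :
    ∃ N : Finset E, N.card ≤ 21 ^ finrank ℝ E ∧ (∀ v ∈ N, ‖v‖ = 1) ∧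
      ∀ u : E, ‖u‖ = 1 → ∃ v ∈ N, ‖u - v‖ ≤ 1 / 10 := by
  have hpack : packingNumber (1 / 10) (sphere (0 : E) 1) ≤ ((21 ^ finrank ℝ E : ℕ) : ℕ∞) := by
    refine iSup_le fun C => iSup_le fun hC => iSup_le fun hsep => ?_
    by_contra! hlt
    -- A separated set could a priori be infinite, so the volume bound is applied to a subset of
    -- exactly `21 ^ d + 1` points.
    obtain ⟨t, ht, hcard⟩ := Set.exists_subset_encard_eq (Order.add_one_le_of_lt hlt)
    have htfin : t.Finite := Set.finite_of_encard_eq_coe (k := 21 ^ finrank ℝ E + 1) (by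
      rw [hcard]; norm_cast)
    have hle := card_le_of_separated_sphere htfin.toFinset
      (fun c hc => by
        have := hC (ht (htfin.mem_toFinset.1 hc))
        simpa using (mem_sphere_zero_iff_norm.1 this).le)
      (fun c hc d hd hcd => by
        have := hsep (ht (htfin.mem_toFinset.1 hc)) (ht (htfin.mem_toFinset.1 hd)) hcd
        beta_reduce at this
        rw [edist_dist, ENNReal.coe_nnreal_eq, ENNReal.ofReal_lt_ofReal_iff_of_nonneg (by simp),
          dist_eq_norm] at this
        simpa using this.le)
    rw [htfin.encard_eq_coe_toFinset_card] at hcard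
    have h3 : htfin.toFinset.card = 21 ^ finrank ℝ E + 1 := by exact_mod_cast hcard
    omega
  have htop : packingNumber (1 / 10) (sphere (0 : E) 1) ≠ ⊤ :=
    ne_top_of_le_ne_top (ENat.natCast_ne_top _) hpack
  have hfin : (maximalSeparatedSet (1 / 10) (sphere (0 : E) 1)).Finite := by
    apply Set.finite_of_encard_le_coe (k := 21 ^ finrank ℝ E)
    rw [encard_maximalSeparatedSet htop]
    exact hpack
  refine ⟨hfin.toFinset, ?_, fun v hv => ?_, fun u hu => ?_⟩
  · rw [← encard_maximalSeparatedSet htop, hfin.encard_eq_coe_toFinset_card] at hpack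
    exact_mod_cast hpack
  · exact mem_sphere_zero_iff_norm.1 (maximalSeparatedSet_subset (hfin.mem_toFinset.1 hv))
  · obtain ⟨v, hv, huv⟩ := isCover_maximalSeparatedSet htop (mem_sphere_zero_iff_norm.2 hu)
    refine ⟨v, hfin.mem_toFinset.2 hv, ?_⟩
    have huv' : edist u v ≤ ((1 / 10 : NNReal) : ENNReal) := huv
    rw [edist_le_coe, ← NNReal.coe_le_coe, coe_nndist, dist_eq_norm] at huv'
    simpa using huv'

/-- A symmetric operator is controlled by its quadratic form on a `1/10`-net of the sphere. -/
lemma norm_le_of_net {E : Type*} [NormedAddCommGroup E] [InnerProductSpace ℝ E]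
    {T : E →L[ℝ] E} (hT : T.IsSymmetric) {N : Finset E}
    (hN : ∀ v ∈ N, ‖v‖ = 1) (hcov : ∀ u : E, ‖u‖ = 1 → ∃ v ∈ N, ‖u - v‖ ≤ 1 / 10)
    {s : ℝ} (hs : 0 ≤ s) (h : ∀ v ∈ N, |inner ℝ (T v) v| ≤ s) : ‖T‖ ≤ 5 / 4 * s := by
  suffices h1 : ‖T‖ ≤ s + 1 / 5 * ‖T‖ by linarith
  have hunit : ∀ u : E, ‖u‖ = 1 → |inner ℝ (T u) u| ≤ s + 1 / 5 * ‖T‖ := by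
    intro u hu
    obtain ⟨v, hv, huv⟩ := hcov u hu
    -- By symmetry the difference of the two forms factors like a difference of squares.
    have e : inner ℝ (T u) u = inner ℝ (T v) v + inner ℝ (T (u - v)) (u + v) := by
      have := hT u v
      simp only [ContinuousLinearMap.coe_coe] at this
      rw [map_sub, inner_sub_left, inner_add_right, inner_add_right, this,
        real_inner_comm u (T v)]
      ring
    have h2 : |inner ℝ (T (u - v)) (u + v)| ≤ 1 / 5 * ‖T‖ := by
      have h4 : ‖u + v‖ ≤ 2 := (norm_add_le _ _).trans (by rw [hu, hN v hv]; norm_num)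
      calc _ ≤ ‖T (u - v)‖ * ‖u + v‖ := abs_real_inner_le_norm _ _
        _ ≤ (‖T‖ * ‖u - v‖) * ‖u + v‖ := by gcongr; exact T.le_opNorm _
        _ ≤ (‖T‖ * (1 / 10)) * 2 := by gcongr
        _ = _ := by ring
    rw [e]
    exact (abs_add_le _ _).trans (add_le_add (h v hv) h2)
  rw [T.norm_eq_iSup_rayleighQuotient hT]
  refine ciSup_le fun x => ?_
  rw [← T.norm_eq_iSup_rayleighQuotient hT]
  by_cases hx : x = 0
  · subst hx
    simp only [ContinuousLinearMap.rayleighQuotient_apply_zero, abs_zero]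
    positivity
  · have hx' : ‖x‖ ≠ 0 := norm_ne_zero_iff.2 hx
    have hn : ‖(‖x‖⁻¹ : ℝ) • x‖ = 1 := by
      rw [norm_smul, norm_inv, norm_norm, inv_mul_cancel₀ hx']
    have := hunit _ hn
    rw [← T.rayleigh_smul x (c := (‖x‖⁻¹ : ℝ)) (inv_ne_zero hx')]
    simpa [ContinuousLinearMap.rayleighQuotient, ContinuousLinearMap.reApplyInnerSelf, hn]
      using this

end Nets

/-! ### Relative deviation on a coordinate subspace -/

section QuadraticForms

open Matrix Module
open scoped MatrixOrder Matrix.Norms.L2Operator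

/-- For a linear map `h : E → ℝᵖ`, quadratic forms pulled back along `h` are controlled on a net
whose size depends only on `dim E`. -/
lemma exists_net_quadraticForm {p : ℕ} {E : Type*} [NormedAddCommGroup E] [InnerProductSpace ℝ E]
    [FiniteDimensional ℝ E] (h : E →ₗ[ℝ] Fin p → ℝ) :
    ∃ N : Finset E, N.card ≤ 21 ^ finrank ℝ E ∧ (∀ v ∈ N, ‖v‖ = 1) ∧
      ∀ M : Matrix (Fin p) (Fin p) ℝ, M.IsSymm → ∀ s : ℝ, 0 ≤ s →
        (∀ v ∈ N, |h v ⬝ᵥ M *ᵥ h v| ≤ s) →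
          ∀ u, |h u ⬝ᵥ M *ᵥ h u| ≤ 5 / 4 * s * ‖u‖ ^ 2 := by
  obtain ⟨N, hcard, hN, hcov⟩ := exists_net_sphere E
  refine ⟨N, hcard, hN, fun M hM s hs hb u => ?_⟩
  let g : E →ₗ[ℝ] EuclideanSpace ℝ (Fin p) := (WithLp.linearEquiv 2 ℝ (Fin p → ℝ)).symm ∘ₗ h
  let T : E →L[ℝ] E := (LinearMap.adjoint g ∘ₗ toEuclideanLin M ∘ₗ g).toContinuousLinearMap
  have hTi : ∀ x y, inner ℝ (T x) y = h y ⬝ᵥ M *ᵥ h x := by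
    intro x y
    simp only [T, LinearMap.coe_toContinuousLinearMap', LinearMap.comp_apply,
      LinearMap.adjoint_inner_left]
    simp [g, PiLp.inner_apply, dotProduct, toEuclideanLin]
  have hTs : T.IsSymmetric := by
    intro x y
    simp only [ContinuousLinearMap.coe_coe]
    rw [hTi, real_inner_comm, hTi, dotProduct_mulVec, dotProduct_comm, ← mulVec_transpose, hM]
  have hnorm := norm_le_of_net hTs hN hcov hs (fun v hv => by rw [hTi]; exact hb v hv)
  rw [← hTi]
  calc _ ≤ ‖T u‖ * ‖u‖ := abs_real_inner_le_norm _ _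
    _ ≤ ‖T‖ * ‖u‖ * ‖u‖ := by gcongr; exact T.le_opNorm _
    _ ≤ 5 / 4 * s * ‖u‖ * ‖u‖ := by gcongr
    _ = _ := by ring

/-- The coordinate subspace `ℝ^F` of `ℝᵖ`. -/
def coordSubspace {p : ℕ} (F : Finset (Fin p)) : Submodule ℝ (Fin p → ℝ) where
  carrier := {v | ∀ i ∉ F, v i = 0}
  add_mem' hv hw i hi := by simp [hv i hi, hw i hi]
  zero_mem' _ _ := rfl
  smul_mem' c v hv i hi := by simp [hv i hi]

lemma finrank_coordSubspace_le {p : ℕ} (F : Finset (Fin p)) :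
    finrank ℝ (coordSubspace F) ≤ F.card := by
  let f : coordSubspace F →ₗ[ℝ] (F → ℝ) :=
    (LinearMap.funLeft ℝ ℝ (Subtype.val : F → Fin p)) ∘ₗ (coordSubspace F).subtype
  have hf : Function.Injective f := by
    rw [← LinearMap.ker_eq_bot, LinearMap.ker_eq_bot']
    intro v hv
    ext i
    by_cases hi : i ∈ F
    · exact congrFun hv ⟨i, hi⟩
    · exact v.2 i hi
  simpa using LinearMap.finrank_le_finrank_of_injective hf

lemma sampleCov_isSymm {n p : ℕ} (X : Data n p) : (sampleCov X).IsSymm := by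
  unfold sampleCov
  rw [IsSymm, transpose_smul, transpose_mul, transpose_transpose]

/-- Uniform deviation of the sample covariance on a coordinate subspace. -/
lemma dataLaw_real_coordSubspace {n p : ℕ} (hn : 1 ≤ n) {S : Matrix (Fin p) (Fin p) ℝ}
    (hS : S.PosDef) (F : Finset (Fin p)) {δ : ℝ} (hδ0 : 0 < δ) (hδ : δ ≤ 1 / 10) :
    (dataLaw n S).real {X | ¬ ∀ v ∈ coordSubspace F,
        |v ⬝ᵥ sampleCov X *ᵥ v - v ⬝ᵥ S *ᵥ v| ≤ δ * (v ⬝ᵥ S *ᵥ v)} ≤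
      2 * 21 ^ F.card * Real.exp (-(n * (11 / 80 * δ ^ 2))) := by
  -- Whitening: `v ↦ B v` turns `vᵀ S v` into a squared norm. A net of the unit sphere of its image
  -- consists of directions of unit variance, which makes the resulting deviation relative to `S`.
  obtain ⟨B, hB⟩ : ∃ B : Matrix (Fin p) (Fin p) ℝ, S = Bᵀ * B := by
    obtain ⟨B, hB⟩ := CStarAlgebra.nonneg_iff_eq_star_mul_self.1 hS.posSemidef.nonneg
    exact ⟨B, by simpa [star_eq_conjTranspose] using hB⟩
  have hSB : ∀ v : Fin p → ℝ, ‖WithLp.toLp 2 (B *ᵥ v)‖ ^ 2 = v ⬝ᵥ S *ᵥ v := by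
    intro v
    rw [hB, ← mulVec_mulVec, dotProduct_mulVec, vecMul_transpose, EuclideanSpace.real_norm_sq_eq]
    simp [dotProduct, sq]
  let g : coordSubspace F →ₗ[ℝ] EuclideanSpace ℝ (Fin p) :=
    (WithLp.linearEquiv 2 ℝ (Fin p → ℝ)).symm ∘ₗ B.mulVecLin ∘ₗ (coordSubspace F).subtype
  have hgn : ∀ v, ‖g v‖ ^ 2 = v.1 ⬝ᵥ S *ᵥ v.1 := fun v => hSB v.1
  have hg : Function.Injective g := by
    rw [← LinearMap.ker_eq_bot, LinearMap.ker_eq_bot']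
    intro v hv
    by_contra hne
    have h1 := hS.dotProduct_mulVec_pos (x := v.1) (fun h => hne (Subtype.ext h))
    have h2 := hgn v
    rw [hv] at h2
    simp at h1 h2
    linarith
  let e := LinearEquiv.ofInjective g hg
  let h : LinearMap.range g →ₗ[ℝ] Fin p → ℝ := (coordSubspace F).subtype ∘ₗ e.symm
  have hh : ∀ u, h u ⬝ᵥ S *ᵥ h u = ‖u‖ ^ 2 := by
    intro u
    have h1 := hgn (e.symm u)
    have h2 : g (e.symm u) = u := congrArg Subtype.val (e.apply_symm_apply u)
    rw [h2] at h1
    simpa [h] using h1.symm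
  obtain ⟨N, hcard, hN, hnet⟩ := exists_net_quadraticForm h
  have hdim : finrank ℝ (LinearMap.range g) ≤ F.card := by
    rw [← e.finrank_eq]
    exact finrank_coordSubspace_le F
  have hsub : {X : Data n p | ¬ ∀ v ∈ coordSubspace F,
        |v ⬝ᵥ sampleCov X *ᵥ v - v ⬝ᵥ S *ᵥ v| ≤ δ * (v ⬝ᵥ S *ᵥ v)} ⊆
      ⋃ u ∈ N, {X : Data n p | 4 / 5 * δ ≤ |h u ⬝ᵥ sampleCov X *ᵥ h u - 1|} := by
    intro X hX
    by_contra hcon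
    simp only [Set.mem_iUnion, Set.mem_ofPred_eq, not_exists, not_le] at hcon
    apply hX
    intro v hv
    have hM : (sampleCov X - S).IsSymm := by
      have hSs : S.IsSymm := by simpa [IsSymm] using hS.isHermitian.eq
      exact (sampleCov_isSymm X).sub hSs
    have := hnet (sampleCov X - S) hM (4 / 5 * δ) (by positivity) (fun u hu => by
      rw [sub_mulVec, dotProduct_sub, hh, hN u hu, one_pow]
      exact (hcon u hu).le) (e ⟨v, hv⟩)
    have hhv : h (e ⟨v, hv⟩) = v := by simp [h]
    rw [← hh, hhv, sub_mulVec, dotProduct_sub] at this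
    linarith
  calc _ ≤ _ := measureReal_mono hsub (measure_ne_top _ _)
    _ ≤ ∑ u ∈ N, _ := measureReal_biUnion_finset_le _ _
    _ ≤ ∑ u ∈ N, 2 * Real.exp (-(n * (9 / 40 * (4 / 5 * δ) ^ 2))) :=
        Finset.sum_le_sum fun u hu => dataLaw_real_abs_sub_one_ge hn hS.posSemidef
          (by rw [hh, hN u hu, one_pow]) (by positivity) (by linarith)
    _ = N.card * (2 * Real.exp (-(n * (9 / 40 * (4 / 5 * δ) ^ 2)))) := by
        rw [Finset.sum_const, nsmul_eq_mul]
    _ ≤ 21 ^ F.card * (2 * Real.exp (-(n * (11 / 80 * δ ^ 2)))) := by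
        have h1 : (N.card : ℝ) ≤ 21 ^ F.card := by
          exact_mod_cast hcard.trans (Nat.pow_le_pow_right (by norm_num) hdim)
        gcongr ?_ * (2 * Real.exp (-(n * ?_)))
        -- `9/40 * (4/5)² = 18/125 ≥ 11/80`.
        nlinarith [sq_nonneg δ]
    _ = _ := by ring

end QuadraticForms
end SparseSpiked

namespace SparseSpiked

open MeasureTheory ProbabilityTheory

/-! ### Entropy and tail estimates for `η` -/

section Numerics

/-- The entropy `m log (e p / m)` of the family of `m`-element subsets of `[p]`. -/
noncomputable def subsetEntropy (m p : ℕ) : ℝ := m * Real.log (Real.exp 1 * p / m)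

/-- The quantity `x_m`, for which `η = 2 x_m + x_m ^ 2`. -/
noncomputable def devRate (m n p : ℕ) (γ : ℝ) : ℝ :=
  √((m : ℝ) / n) + √(γ / n * subsetEntropy m p)

lemma eta_eq (m n p : ℕ) (γ : ℝ) :
    eta m n p γ = 2 * devRate m n p γ + devRate m n p γ ^ 2 := rfl

lemma devRate_nonneg (m n p : ℕ) (γ : ℝ) : 0 ≤ devRate m n p γ := by
  unfold devRate; positivity

lemma eta_nonneg (m n p : ℕ) (γ : ℝ) : 0 ≤ eta m n p γ := by
  rw [eta_eq]
  have := devRate_nonneg m n p γ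
  positivity

lemma two_mul_devRate_le_eta (m n p : ℕ) (γ : ℝ) : 2 * devRate m n p γ ≤ eta m n p γ := by
  rw [eta_eq]
  nlinarith [sq_nonneg (devRate m n p γ)]

lemma log_exp_one_mul_div {m p : ℕ} (hm : 1 ≤ m) (hp : 1 ≤ p) :
    Real.log (Real.exp 1 * p / m) = 1 + Real.log p - Real.log m := by
  have hm' : (m : ℝ) ≠ 0 := by positivity
  have hp' : (p : ℝ) ≠ 0 := by positivity
  rw [Real.log_div (by positivity) hm', Real.log_mul (by positivity) hp', Real.log_exp]

lemma one_le_log_exp_one_mul_div {m p : ℕ} (hm : 1 ≤ m) (hmp : m ≤ p) :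
    1 ≤ Real.log (Real.exp 1 * p / m) := by
  rw [log_exp_one_mul_div hm (hm.trans hmp)]
  have := Real.log_le_log (by positivity : (0 : ℝ) < m) (by exact_mod_cast hmp : (m : ℝ) ≤ p)
  linarith

lemma le_subsetEntropy {m p : ℕ} (hmp : m ≤ p) : (m : ℝ) ≤ subsetEntropy m p := by
  unfold subsetEntropy
  rcases Nat.eq_zero_or_pos m with rfl | hm
  · simp
  · exact le_mul_of_one_le_right (by positivity) (one_le_log_exp_one_mul_div hm hmp)

/-- From `j log (k/j) ≤ k - j` one gets `j log (ep/j) ≤ j log (ep/k) + (k - j)`, and `log (ep/k) ≥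
1` finishes. -/
lemma subsetEntropy_mono {j k p : ℕ} (hjk : j ≤ k) (hkp : k ≤ p) :
    subsetEntropy j p ≤ subsetEntropy k p := by
  rcases Nat.eq_zero_or_pos j with rfl | hj
  · simpa [subsetEntropy] using (Nat.cast_nonneg k).trans (le_subsetEntropy hkp)
  have hk : 1 ≤ k := by omega
  have hj' : (0 : ℝ) < j := by positivity
  have hk' : (0 : ℝ) < k := by positivity
  have h1 := one_le_log_exp_one_mul_div hk hkp
  have h2 : Real.log k - Real.log j ≤ k / j - 1 := by
    rw [← Real.log_div hk'.ne' hj'.ne']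
    exact Real.log_le_sub_one_of_pos (by positivity)
  have h3 : (j : ℝ) * (k / j) = k := by field_simp
  have h4 : (j : ℝ) ≤ k := by exact_mod_cast hjk
  unfold subsetEntropy
  rw [log_exp_one_mul_div hk (hk.trans hkp)] at *
  rw [log_exp_one_mul_div hj (hk.trans hkp)]
  nlinarith [mul_le_mul_of_nonneg_left h2 hj'.le]

/-- Combines `(m - 1)(log p - log m) ≥ 0` with `log m ≤ m/2`. In the union bound `log p` produces
the power of `p`, and `m/2` a geometric series in `m`. -/
lemma log_add_half_le_subsetEntropy {m p : ℕ} (hm : 1 ≤ m) (hmp : m ≤ p) :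
    Real.log p + m / 2 ≤ subsetEntropy m p := by
  have hm' : (1 : ℝ) ≤ m := by exact_mod_cast hm
  have hlog := Real.log_le_log (by positivity : (0 : ℝ) < m) (by exact_mod_cast hmp : (m : ℝ) ≤ p)
  have h2 : Real.log m ≤ m / 2 := by
    have h3 : Real.log (m / 2) ≤ m / 2 - 1 := Real.log_le_sub_one_of_pos (by positivity)
    rw [Real.log_div (by positivity) (by norm_num)] at h3
    have := Real.log_two_lt_d9
    linarith
  unfold subsetEntropy
  rw [log_exp_one_mul_div hm (hm.trans hmp)]
  nlinarith [mul_nonneg (sub_nonneg.2 hm') (sub_nonneg.2 hlog)]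

lemma choose_le_exp_subsetEntropy {m p : ℕ} (hm : 1 ≤ m) (hmp : m ≤ p) :
    (p.choose m : ℝ) ≤ Real.exp (subsetEntropy m p) := by
  have hm' : (0 : ℝ) < m := by positivity
  have hp' : (0 : ℝ) < p := by have := hm.trans hmp; positivity
  have h1 : (m : ℝ) ^ m / m.factorial ≤ Real.exp m := Real.pow_div_factorial_le_exp _ hm'.le _
  calc (p.choose m : ℝ) ≤ (p : ℝ) ^ m / m.factorial := Nat.choose_le_pow_div _ _
    _ = (p / m : ℝ) ^ m * ((m : ℝ) ^ m / m.factorial) := by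
        rw [div_pow]
        field_simp
    _ ≤ (p / m : ℝ) ^ m * Real.exp m := by gcongr
    _ = _ := by
        rw [subsetEntropy, Real.exp_nat_mul, Real.exp_log (by positivity), mul_div_assoc, mul_pow,
          mul_comm, ← Real.exp_nat_mul, mul_one]

/-- The binomial coefficient costs one unit of entropy, leaving the rate `γ/2 - 1 ≥ 4`; the `m/2`
share of the entropy then gives `exp (-2m)`. -/
lemma sum_exp_neg_subsetEntropy_le {p : ℕ} (hp : 1 ≤ p) {γ : ℝ} (hγ : 10 ≤ γ) :
    ∑ D ∈ (Finset.univ : Finset (Fin p)).powerset,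
      (if D.card = 0 then 0 else Real.exp (-(γ / 2 * subsetEntropy D.card p))) ≤
        (p : ℝ) ^ (1 - γ / 2) := by
  have hp' : (0 : ℝ) < p := by positivity
  rw [Finset.sum_powerset_apply_card
    (fun m => if m = 0 then (0 : ℝ) else Real.exp (-(γ / 2 * subsetEntropy m p))),
    Finset.card_univ, Fintype.card_fin, Finset.sum_range_succ']
  simp only [Nat.add_eq_zero_iff, one_ne_zero, and_false, if_false, if_true, smul_zero, add_zero,
    nsmul_eq_mul]
  have hterm : ∀ m ∈ Finset.range p,
      (p.choose (m + 1) : ℝ) * Real.exp (-(γ / 2 * subsetEntropy (m + 1) p)) ≤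
        (p : ℝ) ^ (1 - γ / 2) * (1 / 2) * (1 / 2) ^ m := by
    intro m hm
    have hm1 : m + 1 ≤ p := Finset.mem_range.1 hm
    have h1 := log_add_half_le_subsetEntropy (by omega : 1 ≤ m + 1) hm1
    push_cast at h1
    have hhalf : Real.exp (-2) ≤ 1 / 2 := by
      rw [Real.exp_neg, ← one_div]
      apply one_div_le_one_div_of_le (by norm_num)
      have := Real.add_one_le_exp (2 : ℝ)
      linarith
    calc _ ≤ Real.exp (subsetEntropy (m + 1) p) *
          Real.exp (-(γ / 2 * subsetEntropy (m + 1) p)) := by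
          gcongr
          exact choose_le_exp_subsetEntropy (by omega) hm1
      _ = Real.exp (-((γ / 2 - 1) * subsetEntropy (m + 1) p)) := by
          rw [← Real.exp_add]; congr 1; ring
      _ ≤ Real.exp (Real.log p * (1 - γ / 2) + ((m + 1 : ℕ) : ℝ) * (-2)) := by
          apply Real.exp_le_exp.2
          push_cast
          nlinarith [mul_le_mul_of_nonneg_left h1 (by linarith : 0 ≤ γ / 2 - 1),
            mul_nonneg (by linarith : 0 ≤ γ / 2 - 5) (by positivity : (0 : ℝ) ≤ (m : ℝ) + 1)]
      _ = (p : ℝ) ^ (1 - γ / 2) * Real.exp (-2) ^ (m + 1) := by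
          rw [Real.exp_add, Real.exp_nat_mul, Real.rpow_def_of_pos hp']
      _ ≤ (p : ℝ) ^ (1 - γ / 2) * (1 / 2) ^ (m + 1) := by gcongr
      _ = _ := by ring
  calc _ ≤ _ := Finset.sum_le_sum hterm
    _ = (p : ℝ) ^ (1 - γ / 2) * (1 / 2) * ∑ m ∈ Finset.range p, (1 / 2 : ℝ) ^ m := by
        rw [Finset.mul_sum]
    _ ≤ (p : ℝ) ^ (1 - γ / 2) * (1 / 2) * 2 := by
        gcongr
        exact sum_geometric_two_le p
    _ = _ := by ring

/-- Since the entropy is at least `m` and `γ ≥ 9`, the cross term of the square is at least `6m/n`.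
The resulting `7m` helps pay for the net. -/
lemma mul_devRate_sq_ge {m n p : ℕ} (hn : 1 ≤ n) (hmp : m ≤ p) {γ : ℝ} (hγ : 10 ≤ γ) :
    7 * m + γ * subsetEntropy m p ≤ n * devRate m n p γ ^ 2 := by
  have hn' : (0 : ℝ) < n := by positivity
  have hm : (0 : ℝ) ≤ m := by positivity
  have hL := le_subsetEntropy hmp
  have h1 : √((m : ℝ) / n) ^ 2 = m / n := Real.sq_sqrt (by positivity)
  have h2 : √(γ / n * subsetEntropy m p) ^ 2 = γ / n * subsetEntropy m p :=
    Real.sq_sqrt (mul_nonneg (by positivity) (hm.trans hL))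
  have h3 : 3 * √((m : ℝ) / n) ≤ √(γ / n * subsetEntropy m p) := by
    apply Real.le_sqrt_of_sq_le
    rw [mul_pow, h1]
    calc (3 : ℝ) ^ 2 * (m / n) = 9 / n * m := by ring
      _ ≤ γ / n * subsetEntropy m p := by
        gcongr
        linarith
  have h4 : (n : ℝ) * (m / n) = m := by field_simp
  have h5 : (n : ℝ) * (γ / n * subsetEntropy m p) = γ * subsetEntropy m p := by field_simp
  unfold devRate
  calc 7 * m + γ * subsetEntropy m p
      = n * (m / n + γ / n * subsetEntropy m p + 6 * (m / n)) := by
        rw [mul_add, mul_add, h5, mul_left_comm, h4]; ring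
    _ ≤ _ := by
        gcongr
        nlinarith [Real.sqrt_nonneg ((m : ℝ) / n)]

lemma exp_one_gt : (2.7 : ℝ) < Real.exp 1 := by
  have := Real.exp_one_gt_d9
  linarith

/-- With `η ≥ 2x` the exponent is at least `11/20 (7m + γL)`, `L` being the entropy. Here `77/20 m +
γL/20 ≥ 4m` beats `log (2 * 21^m)`, and `γL/2` remains. -/
lemma tail_eta_le {m n p : ℕ} (hn : 1 ≤ n) (hm : 1 ≤ m) (hmp : m ≤ p) {γ : ℝ} (hγ : 10 ≤ γ) :
    2 * 21 ^ m * Real.exp (-(n * (11 / 80 * eta m n p γ ^ 2))) ≤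
      Real.exp (-(γ / 2 * subsetEntropy m p)) := by
  have h1 := mul_devRate_sq_ge hn hmp hγ
  have hL := le_subsetEntropy hmp
  have h2 : (2 * devRate m n p γ) ^ 2 ≤ eta m n p γ ^ 2 :=
    pow_le_pow_left₀ (by have := devRate_nonneg m n p γ; positivity)
      (two_mul_devRate_le_eta m n p γ) 2
  have h3 : (2 : ℝ) * 21 ^ m ≤ Real.exp (4 * m) := by
    calc (2 : ℝ) * 21 ^ m ≤ 2 ^ m * 21 ^ m := by
          gcongr
          exact le_self_pow₀ (by norm_num) (by omega)
      _ = 42 ^ m := by rw [← mul_pow]; norm_num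
      _ ≤ (Real.exp 1 ^ 4) ^ m := by
          gcongr
          calc (42 : ℝ) ≤ 2.7 ^ 4 := by norm_num
            _ ≤ _ := by gcongr; exact exp_one_gt.le
      _ = _ := by
          rw [← Real.exp_nat_mul, ← Real.exp_nat_mul]
          congr 1; push_cast; ring
  calc _ ≤ Real.exp (4 * m) * Real.exp (-(n * (11 / 80 * eta m n p γ ^ 2))) := by gcongr
    _ = Real.exp (4 * m + -(n * (11 / 80 * eta m n p γ ^ 2))) := (Real.exp_add _ _).symm
    _ ≤ _ := by
      apply Real.exp_le_exp.2
      have h4 := mul_le_mul_of_nonneg_left h2 (by positivity : (0 : ℝ) ≤ n)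
      nlinarith [mul_le_mul hγ hL (by positivity) (by linarith)]

/-- On `ℝ^(A ∪ D)` the dimension may reach `2k`; the factor `9/5` in the radius pays for the larger
net. -/
lemma tail_eta_union_le {m k n p : ℕ} (hn : 1 ≤ n) (hk : 1 ≤ k) (hm : m ≤ 2 * k) (hkp : k ≤ p)
    {γ : ℝ} (hγ : 10 ≤ γ) :
    2 * 21 ^ m * Real.exp (-(n * (11 / 80 * (9 / 5 * eta k n p γ) ^ 2))) ≤
      Real.exp (-(γ / 2 * subsetEntropy k p)) := by
  have h1 := mul_devRate_sq_ge hn hkp hγ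
  have hL := le_subsetEntropy hkp
  have h2 : (2 * devRate k n p γ) ^ 2 ≤ eta k n p γ ^ 2 :=
    pow_le_pow_left₀ (by have := devRate_nonneg k n p γ; positivity)
      (two_mul_devRate_le_eta k n p γ) 2
  have h3 : (2 : ℝ) * 21 ^ m ≤ Real.exp (7 * k) := by
    calc (2 : ℝ) * 21 ^ m ≤ 2 ^ k * 21 ^ (2 * k) := by
          gcongr
          · exact le_self_pow₀ (by norm_num) (by omega)
          · norm_num
      _ = 882 ^ k := by rw [pow_mul, ← mul_pow]; norm_num
      _ ≤ (Real.exp 1 ^ 7) ^ k := by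
          gcongr
          calc (882 : ℝ) ≤ 2.7 ^ 7 := by norm_num
            _ ≤ _ := by gcongr; exact exp_one_gt.le
      _ = _ := by
          rw [← Real.exp_nat_mul, ← Real.exp_nat_mul]
          congr 1; push_cast; ring
  calc _ ≤ Real.exp (7 * k) * Real.exp (-(n * (11 / 80 * (9 / 5 * eta k n p γ) ^ 2))) := by
        gcongr
    _ = Real.exp (7 * k + -(n * (11 / 80 * (9 / 5 * eta k n p γ) ^ 2))) := (Real.exp_add _ _).symm
    _ ≤ _ := by
      apply Real.exp_le_exp.2
      have h4 := mul_le_mul_of_nonneg_left h2 (by positivity : (0 : ℝ) ≤ n)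
      nlinarith [mul_le_mul hγ hL (by positivity) (by linarith)]

lemma eta_mono {j k n p : ℕ} (hjk : j ≤ k) (hkp : k ≤ p) {γ : ℝ} (hγ : 10 ≤ γ) :
    eta j n p γ ≤ eta k n p γ := by
  have h1 : devRate j n p γ ≤ devRate k n p γ := by
    unfold devRate
    gcongr
    exact subsetEntropy_mono hjk hkp
  have := devRate_nonneg j n p γ
  rw [eta_eq, eta_eq]
  gcongr

lemma eta_pos {k n p : ℕ} (hn : 1 ≤ n) (hk : 1 ≤ k) {γ : ℝ} : 0 < eta k n p γ := by
  refine lt_of_lt_of_le ?_ (two_mul_devRate_le_eta k n p γ)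
  have : 0 < √((k : ℝ) / n) := Real.sqrt_pos.2 (by positivity)
  unfold devRate
  positivity

lemma eta_le {k n p : ℕ} (hn : 1 ≤ n) (hk : 1 ≤ k) (hkp : k ≤ p) {γ : ℝ} (hγ : 10 ≤ γ)
    (hsmall : (1 + √γ) * √((k : ℝ) / n * Real.log (Real.exp 1 * p / k)) ≤ 1) :
    eta k n p γ ≤ 3 * (1 + √γ) * √((k : ℝ) / n * Real.log (Real.exp 1 * p / k)) := by
  have hL := one_le_log_exp_one_mul_div hk hkp
  have h1 : devRate k n p γ ≤ (1 + √γ) * √((k : ℝ) / n * Real.log (Real.exp 1 * p / k)) := by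
    unfold devRate subsetEntropy
    rw [add_mul, one_mul, ← Real.sqrt_mul (by linarith)]
    refine add_le_add (Real.sqrt_le_sqrt ?_) (Real.sqrt_le_sqrt (le_of_eq (by ring)))
    exact le_mul_of_one_le_right (by positivity) hL
  rw [eta_eq]
  nlinarith [devRate_nonneg k n p γ]

end Numerics
end SparseSpiked

namespace SparseSpiked

/-! ### Spectral norm and bilinear forms -/

section SpectralNorm

open Matrix

lemma inner_toEuclideanLin {m n : Type} [Fintype m] [Fintype n] [DecidableEq n]
    (M : Matrix m n ℝ) (u : EuclideanSpace ℝ m) (v : EuclideanSpace ℝ n) :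
    inner ℝ (toEuclideanLin M v) u = u.ofLp ⬝ᵥ M *ᵥ v.ofLp := by
  simp [PiLp.inner_apply, dotProduct, toEuclideanLin]

lemma real_norm_toLp_sq {n : Type} [Fintype n] (v : n → ℝ) :
    ‖WithLp.toLp 2 v‖ ^ 2 = v ⬝ᵥ v := by
  rw [EuclideanSpace.real_norm_sq_eq]
  simp [dotProduct, sq]

lemma norm_toLp {n : Type} [Fintype n] (v : n → ℝ) :
    ‖WithLp.toLp 2 v‖ = √(v ⬝ᵥ v) := by
  rw [← real_norm_toLp_sq, Real.sqrt_sq (norm_nonneg _)]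

lemma specNorm_nonneg {m n : Type} [Fintype m] [Fintype n] [DecidableEq n] (M : Matrix m n ℝ) :
    0 ≤ specNorm M := norm_nonneg _

lemma abs_dotProduct_mulVec_le {m n : Type} [Fintype m] [Fintype n] [DecidableEq n]
    (M : Matrix m n ℝ) (u : m → ℝ) (v : n → ℝ) :
    |u ⬝ᵥ M *ᵥ v| ≤ specNorm M * √(u ⬝ᵥ u) * √(v ⬝ᵥ v) := by
  have h := inner_toEuclideanLin M (WithLp.toLp 2 u) (WithLp.toLp 2 v)
  simp only at h
  rw [← h, ← norm_toLp, ← norm_toLp]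
  calc _ ≤ ‖toEuclideanLin M (WithLp.toLp 2 v)‖ * ‖WithLp.toLp 2 u‖ := abs_real_inner_le_norm _ _
    _ ≤ specNorm M * ‖WithLp.toLp 2 v‖ * ‖WithLp.toLp 2 u‖ := by
        gcongr
        exact (toEuclideanLin M).toContinuousLinearMap.le_opNorm _
    _ = _ := by ring

lemma specNorm_le {m n : Type} [Fintype m] [Fintype n] [DecidableEq n]
    {M : Matrix m n ℝ} {c : ℝ} (hc : 0 ≤ c)
    (h : ∀ u v, |u ⬝ᵥ M *ᵥ v| ≤ c * √(u ⬝ᵥ u) * √(v ⬝ᵥ v)) : specNorm M ≤ c := by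
  refine ContinuousLinearMap.opNorm_le_bound _ hc fun v => ?_
  set w := (toEuclideanLin M).toContinuousLinearMap v with hw
  have h1 := h w.ofLp v.ofLp
  rw [← inner_toEuclideanLin, ← norm_toLp, ← norm_toLp] at h1
  have h2 : inner ℝ (toEuclideanLin M v) w = ‖w‖ ^ 2 := real_inner_self_eq_norm_sq w
  rw [h2, abs_of_nonneg (by positivity)] at h1
  change ‖w‖ ^ 2 ≤ c * ‖w‖ * ‖v‖ at h1
  rcases (norm_nonneg w).eq_or_lt with h0 | h0
  · rw [← h0]; positivity
  · refine le_of_mul_le_mul_left ?_ h0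
    linarith

/-- Polarization: a symmetric bilinear form dominated by a quadratic form on a subspace satisfies
the corresponding Cauchy-Schwarz inequality. -/
lemma abs_dotProduct_mulVec_le_of_quadraticForm {n : Type} [Fintype n]
    {M Q : Matrix n n ℝ} (hM : M.IsSymm) (hQ : Q.IsSymm) (W : Submodule ℝ (n → ℝ)) {c : ℝ}
    (hQ0 : ∀ v ∈ W, 0 ≤ v ⬝ᵥ Q *ᵥ v)
    (h : ∀ v ∈ W, |v ⬝ᵥ M *ᵥ v| ≤ c * (v ⬝ᵥ Q *ᵥ v)) {u v : n → ℝ} (hu : u ∈ W) (hv : v ∈ W)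
    (hc : 0 ≤ c) :
    |u ⬝ᵥ M *ᵥ v| ≤ c * √(u ⬝ᵥ Q *ᵥ u) * √(v ⬝ᵥ Q *ᵥ v) := by
  have symm : ∀ {N : Matrix n n ℝ}, N.IsSymm → ∀ x y, x ⬝ᵥ N *ᵥ y = y ⬝ᵥ N *ᵥ x := by
    intro N hN x y
    rw [dotProduct_mulVec, dotProduct_comm, ← mulVec_transpose, hN]
  have key : ∀ x ∈ W, ∀ y ∈ W, 2 * |x ⬝ᵥ M *ᵥ y| ≤ c * (x ⬝ᵥ Q *ᵥ x + y ⬝ᵥ Q *ᵥ y) := by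
    intro x hx y hy
    have h1 := abs_le.1 (h (x + y) (W.add_mem hx hy))
    have h2 := abs_le.1 (h (x - y) (W.sub_mem hx hy))
    simp only [mulVec_add, mulVec_sub, dotProduct_add, dotProduct_sub, add_dotProduct,
      sub_dotProduct] at h1 h2
    rw [symm hM y x, symm hQ y x] at h1 h2
    have : |x ⬝ᵥ M *ᵥ y| ≤ c * (x ⬝ᵥ Q *ᵥ x + y ⬝ᵥ Q *ᵥ y) / 2 := abs_le.2 ⟨by linarith, by linarith⟩
    linarith
  set a := √(u ⬝ᵥ Q *ᵥ u) with ha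
  set b := √(v ⬝ᵥ Q *ᵥ v) with hb
  have ha2 : a ^ 2 = u ⬝ᵥ Q *ᵥ u := Real.sq_sqrt (hQ0 u hu)
  have hb2 : b ^ 2 = v ⬝ᵥ Q *ᵥ v := Real.sq_sqrt (hQ0 v hv)
  have ha0 : 0 ≤ a := Real.sqrt_nonneg _
  have hb0 : 0 ≤ b := Real.sqrt_nonneg _
  have scaled : ∀ s t : ℝ, 0 ≤ s → 0 ≤ t →
      2 * (s * t * |u ⬝ᵥ M *ᵥ v|) ≤ c * (s ^ 2 * a ^ 2 + t ^ 2 * b ^ 2) := by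
    intro s t hs ht
    have := key (s • u) (W.smul_mem s hu) (t • v) (W.smul_mem t hv)
    simp only [mulVec_smul, dotProduct_smul, smul_dotProduct, smul_eq_mul, abs_mul,
      abs_of_nonneg hs, abs_of_nonneg ht] at this
    rw [ha2, hb2]
    linarith
  -- The balanced weights are `s = b`, `t = a`; the shift by `ε` keeps them positive when `a` or `b`
  -- vanishes.
  have hfin : ∀ ε : ℝ, 0 < ε → |u ⬝ᵥ M *ᵥ v| ≤ c * ((a + ε) * (b + ε)) := by
    intro ε hε
    have h1 := scaled (b + ε) (a + ε) (by linarith) (by linarith)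
    have hpos : 0 < (b + ε) * (a + ε) := by positivity
    have h2 : (b + ε) ^ 2 * a ^ 2 + (a + ε) ^ 2 * b ^ 2 ≤
        2 * ((b + ε) * (a + ε)) * ((b + ε) * (a + ε)) := by
      have e1 : a ^ 2 ≤ (a + ε) ^ 2 := by gcongr; linarith
      have e2 : b ^ 2 ≤ (b + ε) ^ 2 := by gcongr; linarith
      nlinarith [mul_le_mul_of_nonneg_left e1 (sq_nonneg (b + ε)),
        mul_le_mul_of_nonneg_left e2 (sq_nonneg (a + ε))]
    have h3 := mul_le_mul_of_nonneg_left h2 hc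
    refine le_of_mul_le_mul_left ?_ hpos
    nlinarith
  have hlim : Filter.Tendsto (fun ε : ℝ => c * ((a + ε) * (b + ε))) (nhdsWithin 0 (Set.Ioi 0))
      (nhds (c * ((a + 0) * (b + 0)))) :=
    (Continuous.tendsto (by fun_prop) 0).mono_left nhdsWithin_le_nhds
  have := ge_of_tendsto hlim (eventually_nhdsWithin_of_forall hfin)
  simpa [mul_assoc] using this

end SpectralNorm

/-! ### Courant-Fischer bounds for singular values -/

section SingularValues

open Module Matrix

variable {E : Type*} [NormedAddCommGroup E] [InnerProductSpace ℝ E] [FiniteDimensional ℝ E]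

lemma inner_apply_self_eq_sum_eigenvalues {T : E →ₗ[ℝ] E} (hT : T.IsSymmetric) {d : ℕ}
    (hd : finrank ℝ E = d) (x : E) :
    inner ℝ (T x) x =
      ∑ i, hT.eigenvalues hd i * inner ℝ (hT.eigenvectorBasis hd i) x ^ 2 := by
  rw [← (hT.eigenvectorBasis hd).sum_inner_mul_inner (T x) x]
  refine Finset.sum_congr rfl fun i _ => ?_
  rw [hT x, hT.apply_eigenvectorBasis, real_inner_smul_right, real_inner_comm x]
  simp only [RCLike.ofReal_real_eq_id, id]
  ring

/-- Courant-Fischer lower bound for the sorted eigenvalues. -/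
lemma le_eigenvalues_of_injective {T : E →ₗ[ℝ] E} (hT : T.IsSymmetric) {d m : ℕ}
    (hd : finrank ℝ E = d) (hm : m < d) {c : ℝ} (f : (Fin (m + 1) → ℝ) →ₗ[ℝ] E)
    (hf : Function.Injective f) (h : ∀ a, c * ‖f a‖ ^ 2 ≤ inner ℝ (T (f a)) (f a)) :
    c ≤ hT.eigenvalues hd ⟨m, hm⟩ := by
  let b := hT.eigenvectorBasis hd
  let g : (Fin (m + 1) → ℝ) →ₗ[ℝ] (Fin m → ℝ) :=
    LinearMap.pi fun j => (innerₛₗ ℝ (b ⟨j, j.2.trans hm⟩)) ∘ₗ f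
  obtain ⟨a, ha, ha0⟩ := (Submodule.ne_bot_iff _).1
    (LinearMap.ker_ne_bot_of_finrank_lt (f := g) (by simp))
  have hx0 : f a ≠ 0 := fun h0 => ha0 (hf (by rw [h0, map_zero]))
  have hcoord : ∀ i : Fin d, i.1 < m → inner ℝ (b i) (f a) = 0 := fun i hi =>
    congrFun (LinearMap.mem_ker.1 ha) ⟨i, hi⟩
  have h1 := h a
  rw [inner_apply_self_eq_sum_eigenvalues hT hd, ← b.sum_sq_inner_right, Finset.mul_sum] at h1
  by_contra! hlt
  have h2 : ∑ i, hT.eigenvalues hd i * inner ℝ (b i) (f a) ^ 2 <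
      ∑ i, c * inner ℝ (b i) (f a) ^ 2 := by
    have hle : ∀ i : Fin d, m ≤ i.1 → hT.eigenvalues hd i < c := fun i hi =>
      (hT.eigenvalues_antitone hd (show (⟨m, hm⟩ : Fin d) ≤ i from hi)).trans_lt hlt
    have hex : ∃ i, inner ℝ (b i) (f a) ≠ 0 := by
      by_contra! hall
      exact hx0 (b.toBasis.ext_elem_iff.2 fun i => by simp [b.repr_apply_apply, hall i])
    obtain ⟨i, hi⟩ := hex
    refine Finset.sum_lt_sum (fun j _ => ?_) ⟨i, Finset.mem_univ _, ?_⟩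
    · rcases lt_or_ge j.1 m with hj | hj
      · rw [hcoord j hj]; simp
      · exact mul_le_mul_of_nonneg_right (hle j hj).le (sq_nonneg _)
    · have hmi : m ≤ i.1 := by
        by_contra! hlt'
        exact hi (hcoord i hlt')
      exact mul_lt_mul_of_pos_right (hle i hmi) (by positivity)
  exact absurd h1 (not_le.2 h2)

/-- Courant-Fischer upper bound for the sorted eigenvalues. -/
lemma eigenvalues_le_of_ker {T : E →ₗ[ℝ] E} (hT : T.IsSymmetric) {d m : ℕ}
    (hd : finrank ℝ E = d) (hm : m < d) {c : ℝ} (C : E →ₗ[ℝ] (Fin m → ℝ))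
    (h : ∀ x, C x = 0 → inner ℝ (T x) x ≤ c * ‖x‖ ^ 2) :
    hT.eigenvalues hd ⟨m, hm⟩ ≤ c := by
  let b := hT.eigenvectorBasis hd
  let f : (Fin (m + 1) → ℝ) →ₗ[ℝ] E :=
    Fintype.linearCombination ℝ (fun j : Fin (m + 1) => b ⟨j, by omega⟩)
  obtain ⟨a, ha, ha0⟩ := (Submodule.ne_bot_iff _).1
    (LinearMap.ker_ne_bot_of_finrank_lt (f := C ∘ₗ f) (by simp))
  have hcoord : ∀ i : Fin d, inner ℝ (b i) (f a) = ∑ j : Fin (m + 1), if i.1 = j.1 then a j else 0 := by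
    intro i
    simp only [f, Fintype.linearCombination_apply, inner_sum, real_inner_smul_right]
    refine Finset.sum_congr rfl fun j _ => ?_
    rw [orthonormal_iff_ite.1 b.orthonormal]
    simp [Fin.ext_iff]
  have hlow : ∀ j : Fin (m + 1), inner ℝ (b ⟨j, by omega⟩) (f a) = a j := by
    intro j
    rw [hcoord]
    simp [← Fin.ext_iff]
  have hhigh : ∀ i : Fin d, m < i.1 → inner ℝ (b i) (f a) = 0 := by
    intro i hi
    rw [hcoord]
    exact Finset.sum_eq_zero fun j _ => if_neg (by omega)
  have hx0 : f a ≠ 0 := fun h0 => ha0 (funext fun j => by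
    rw [← hlow j, h0, inner_zero_right]; rfl)
  have h1 := h (f a) (LinearMap.mem_ker.1 ha)
  have h2 : hT.eigenvalues hd ⟨m, hm⟩ * ‖f a‖ ^ 2 ≤ inner ℝ (T (f a)) (f a) := by
    rw [inner_apply_self_eq_sum_eigenvalues hT hd, ← b.sum_sq_inner_right, Finset.mul_sum]
    refine Finset.sum_le_sum fun i _ => ?_
    rcases lt_or_ge m i.1 with hi | hi
    · rw [hhigh i hi]
      simp
    · exact mul_le_mul_of_nonneg_right
        (hT.eigenvalues_antitone hd (show i ≤ (⟨m, hm⟩ : Fin d) from hi)) (sq_nonneg _)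
  exact le_of_mul_le_mul_right (h2.trans h1) (by positivity)

lemma real_inner_adjoint_comp_self {F : Type*} [NormedAddCommGroup F] [InnerProductSpace ℝ F]
    [FiniteDimensional ℝ F] (T : E →ₗ[ℝ] F) (x : E) :
    inner ℝ ((LinearMap.adjoint T ∘ₗ T) x) x = ‖T x‖ ^ 2 := by
  rw [LinearMap.comp_apply, LinearMap.adjoint_inner_left, real_inner_self_eq_norm_sq]

/-- Symmetry is not needed: Cauchy-Schwarz turns the form bound into `‖T x‖ ≥ c ‖x‖`, to which
Courant-Fischer for `T* T` applies. -/
lemma le_singularValues {T : E →ₗ[ℝ] E} {m : ℕ} {c : ℝ} (hc : 0 ≤ c)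
    (f : (Fin (m + 1) → ℝ) →ₗ[ℝ] E) (hf : Function.Injective f)
    (h : ∀ a, c * ‖f a‖ ^ 2 ≤ inner ℝ (T (f a)) (f a)) : c ≤ T.singularValues m := by
  have hm : m < finrank ℝ E := by
    have := LinearMap.finrank_le_finrank_of_injective hf
    simpa using this
  refine le_of_sq_le_sq ?_ (T.singularValues_nonneg m)
  rw [T.sq_singularValues_of_lt rfl hm]
  refine le_eigenvalues_of_injective _ rfl hm f hf fun a => ?_
  rw [real_inner_adjoint_comp_self]
  rcases (norm_nonneg (f a)).eq_or_lt with h0 | h0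
  · rw [← h0]; simp
  · have h1 : c * ‖f a‖ ≤ ‖T (f a)‖ := by
      refine le_of_mul_le_mul_right ?_ h0
      have := (h a).trans (real_inner_le_norm _ _)
      linarith
    rw [← mul_pow]
    exact pow_le_pow_left₀ (by positivity) h1 2

/-- For positive semidefinite `T` the eigenvalues bound the singular values: on vectors whose first
`m` eigencoordinates vanish, `T* T` is at most the square of the eigenvalue of index `m`. -/
lemma singularValues_le {T : E →ₗ[ℝ] E} (hT : T.IsSymmetric)
    (hpos : ∀ x, 0 ≤ inner ℝ (T x) x) {m : ℕ} {c : ℝ} (hc : 0 ≤ c) (C : E →ₗ[ℝ] (Fin m → ℝ))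
    (h : ∀ x, C x = 0 → inner ℝ (T x) x ≤ c * ‖x‖ ^ 2) : T.singularValues m ≤ c := by
  rcases lt_or_ge m (finrank ℝ E) with hm | hm
  swap
  · rwa [T.singularValues_of_finrank_le hm]
  have hμ := eigenvalues_le_of_ker hT rfl hm C h
  let b := hT.eigenvectorBasis rfl
  have hnn : ∀ i, 0 ≤ hT.eigenvalues rfl i := by
    intro i
    have h1 := hpos (b i)
    rw [hT.apply_eigenvectorBasis, real_inner_smul_left, real_inner_self_eq_norm_sq,
      b.orthonormal.1 i] at h1
    simpa using h1
  refine le_of_sq_le_sq ?_ hc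
  rw [T.sq_singularValues_of_lt rfl hm]
  refine eigenvalues_le_of_ker _ rfl hm
    (LinearMap.pi fun j : Fin m => innerₛₗ ℝ (b ⟨j, j.2.trans hm⟩)) fun x hx => ?_
  rw [real_inner_adjoint_comp_self, ← b.sum_sq_inner_right (T x), ← b.sum_sq_inner_right x,
    Finset.mul_sum]
  refine Finset.sum_le_sum fun i _ => ?_
  have hTi : inner ℝ (b i) (T x) = hT.eigenvalues rfl i * inner ℝ (b i) x := by
    rw [← hT (b i) x, hT.apply_eigenvectorBasis, real_inner_smul_left]
    simp [b]
  rw [hTi, mul_pow]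
  rcases lt_or_ge i.1 m with hi | hi
  · rw [show inner ℝ (b i) x = 0 from congrFun hx ⟨i, hi⟩]
    simp
  · gcongr
    · exact hnn i
    · exact (hT.eigenvalues_antitone rfl (show (⟨m, hm⟩ : Fin _) ≤ i from hi)).trans hμ

lemma le_singVal {ι : Type} [Fintype ι] [DecidableEq ι] {M : Matrix ι ι ℝ} {r : ℕ} (hr : 1 ≤ r)
    {c : ℝ} (hc : 0 ≤ c) (f : (Fin r → ℝ) →ₗ[ℝ] (ι → ℝ)) (hf : Function.Injective f)
    (h : ∀ a, c * (f a ⬝ᵥ f a) ≤ f a ⬝ᵥ M *ᵥ f a) : c ≤ singVal M r := by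
  obtain ⟨m, rfl⟩ : ∃ m, r = m + 1 := ⟨r - 1, by omega⟩
  refine le_singularValues hc ((WithLp.linearEquiv 2 ℝ (ι → ℝ)).symm ∘ₗ f)
    (fun x y hxy => hf ((WithLp.linearEquiv 2 ℝ (ι → ℝ)).symm.injective hxy)) fun a => ?_
  rw [inner_toEuclideanLin]
  have := h a
  rw [← real_norm_toLp_sq] at this
  exact this

lemma singVal_le {ι : Type} [Fintype ι] [DecidableEq ι] {M : Matrix ι ι ℝ} (hM : M.IsSymm)
    (hpos : ∀ v, 0 ≤ v ⬝ᵥ M *ᵥ v) {r : ℕ} {c : ℝ} (hc : 0 ≤ c)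
    (C : (ι → ℝ) →ₗ[ℝ] (Fin r → ℝ))
    (h : ∀ v, C v = 0 → v ⬝ᵥ M *ᵥ v ≤ c * (v ⬝ᵥ v)) : singVal M (r + 1) ≤ c := by
  refine singularValues_le (fun x y => ?_) (fun x => ?_) hc
    (C ∘ₗ (WithLp.linearEquiv 2 ℝ (ι → ℝ)).toLinearMap) fun x hx => ?_
  · rw [real_inner_comm (toEuclideanLin M y) x, inner_toEuclideanLin, inner_toEuclideanLin,
      dotProduct_mulVec, dotProduct_comm, ← mulVec_transpose, hM]
  · rw [inner_toEuclideanLin]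
    exact hpos _
  · rw [inner_toEuclideanLin]
    have := h x.ofLp hx
    rwa [← real_norm_toLp_sq] at this

/-- Truncated subtraction makes the indices `0` and `1` agree, so no case is lost at `0`. -/
lemma singVal_antitone {ι : Type} [Fintype ι] [DecidableEq ι] (M : Matrix ι ι ℝ) :
    Antitone (singVal M) := fun _ _ h =>
  (toEuclideanLin M).singularValues_antitone (Nat.sub_le_sub_right h 1)

end SingularValues
end SparseSpiked

namespace SparseSpiked

open Matrix

lemma real_dotProduct_self_nonneg {ι : Type*} [Fintype ι] (v : ι → ℝ) : 0 ≤ v ⬝ᵥ v :=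
  Finset.sum_nonneg fun _ _ => mul_self_nonneg _

lemma real_dotProduct_self_pos {ι : Type*} [Fintype ι] {v : ι → ℝ} (hv : v ≠ 0) : 0 < v ⬝ᵥ v :=
  (real_dotProduct_self_nonneg v).lt_of_ne fun h => hv (dotProduct_self_eq_zero.1 h.symm)

/-! ### Coordinate restriction, blocks and padding -/

section Restriction

variable {p : ℕ}

/-- Restriction of a vector to the coordinates in `D`. -/
def restrictTo (D : Finset (Fin p)) (v : Fin p → ℝ) : Fin p → ℝ := fun i => if i ∈ D then v i else 0

/-- Extension by zero from `ℝ^D` to `ℝᵖ`. -/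
def extendZero (D : Finset (Fin p)) : (D → ℝ) →ₗ[ℝ] (Fin p → ℝ) where
  toFun u := fun i => if h : i ∈ D then u ⟨i, h⟩ else 0
  map_add' u v := by ext i; by_cases h : i ∈ D <;> simp [h]
  map_smul' c u := by ext i; by_cases h : i ∈ D <;> simp [h]

lemma extendZero_mem (D : Finset (Fin p)) (u : D → ℝ) : extendZero D u ∈ coordSubspace D :=
  fun i hi => by simp [extendZero, hi]

lemma restrictTo_mem (D : Finset (Fin p)) (v : Fin p → ℝ) : restrictTo D v ∈ coordSubspace D :=
  fun i hi => by simp [restrictTo, hi]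

lemma coordSubspace_mono {D F : Finset (Fin p)} (h : D ⊆ F) : coordSubspace D ≤ coordSubspace F :=
  fun _ hv i hi => hv i fun hD => hi (h hD)

lemma extendZero_dotProduct (D : Finset (Fin p)) (u : D → ℝ) (g : Fin p → ℝ) :
    extendZero D u ⬝ᵥ g = ∑ i : D, u i * g i := by
  unfold dotProduct
  rw [← Finset.sum_subset (Finset.subset_univ D)
    (fun i _ hi => by rw [extendZero_mem D u i hi, zero_mul]), ← Finset.sum_coe_sort D]
  exact Finset.sum_congr rfl fun i _ => by simp [extendZero]

lemma extendZero_dotProduct_self (D : Finset (Fin p)) (u : D → ℝ) :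
    extendZero D u ⬝ᵥ extendZero D u = u ⬝ᵥ u := by
  rw [extendZero_dotProduct]
  exact Finset.sum_congr rfl fun i _ => by simp [extendZero]

lemma dotProduct_block_mulVec (M : Matrix (Fin p) (Fin p) ℝ) (D B : Finset (Fin p)) (u : D → ℝ)
    (w : B → ℝ) : u ⬝ᵥ block M D B *ᵥ w = extendZero D u ⬝ᵥ M *ᵥ extendZero B w := by
  rw [extendZero_dotProduct]
  refine Finset.sum_congr rfl fun i _ => ?_
  simp only [mulVec]
  rw [dotProduct_comm (M i.1), extendZero_dotProduct]
  congr 1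
  exact Finset.sum_congr rfl fun j _ => mul_comm _ _

lemma extendZero_coe {D : Finset (Fin p)} {v : Fin p → ℝ} (hv : v ∈ coordSubspace D) :
    extendZero D (fun i => v i) = v := by
  ext i
  by_cases h : i ∈ D
  · simp [extendZero, h]
  · simp [extendZero, h, hv i h]

lemma restrictTo_eq_mulVec (D : Finset (Fin p)) (v : Fin p → ℝ) :
    restrictTo D v = diagonal (fun i => if i ∈ D then (1 : ℝ) else 0) *ᵥ v := by
  ext i
  simp [restrictTo, mulVec_diagonal]

lemma dotProduct_restrictTo (D : Finset (Fin p)) (u v : Fin p → ℝ) :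
    u ⬝ᵥ diagonal (fun i => if i ∈ D then (1 : ℝ) else 0) *ᵥ v = restrictTo D u ⬝ᵥ v := by
  refine Finset.sum_congr rfl fun i _ => ?_
  simp [restrictTo, mulVec_diagonal]

/-- As a compression of `M - 1`, the padded matrix minus the identity sees only the coordinates in
`D`. -/
lemma padded_eq (M : Matrix (Fin p) (Fin p) ℝ) (D : Finset (Fin p)) :
    padded M D = diagonal (fun i => if i ∈ D then (1 : ℝ) else 0) * (M - 1) *
      diagonal (fun i => if i ∈ D then (1 : ℝ) else 0) + 1 := by
  ext i j
  by_cases hi : i ∈ D <;> by_cases hj : j ∈ D <;> by_cases hij : i = j <;>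
    simp_all [padded]

lemma dotProduct_padded_sub_one_mulVec (M : Matrix (Fin p) (Fin p) ℝ) (D : Finset (Fin p))
    (u v : Fin p → ℝ) :
    u ⬝ᵥ (padded M D - 1) *ᵥ v = restrictTo D u ⬝ᵥ (M - 1) *ᵥ restrictTo D v := by
  rw [padded_eq, add_sub_cancel_right, ← mulVec_mulVec, ← mulVec_mulVec, dotProduct_restrictTo,
    ← restrictTo_eq_mulVec]

lemma restrictTo_dotProduct_self_le (D : Finset (Fin p)) (v : Fin p → ℝ) :
    restrictTo D v ⬝ᵥ restrictTo D v ≤ v ⬝ᵥ v := by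
  refine Finset.sum_le_sum fun i _ => ?_
  by_cases h : i ∈ D
  · simp [restrictTo, h]
  · simp [restrictTo, h, mul_self_nonneg]

lemma restrictTo_of_mem {D : Finset (Fin p)} {v : Fin p → ℝ} (hv : v ∈ coordSubspace D) :
    restrictTo D v = v := by
  ext i
  by_cases h : i ∈ D
  · simp [restrictTo, h]
  · simp [restrictTo, h, hv i h]

lemma restrictTo_add_sdiff {A : Finset (Fin p)} (B : Finset (Fin p)) {v : Fin p → ℝ}
    (hv : v ∈ coordSubspace A) : restrictTo B v + restrictTo (A \ B) v = v := by
  ext i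
  by_cases hB : i ∈ B <;> by_cases hA : i ∈ A <;> simp [restrictTo, hA, hB]
  exact (hv i hA).symm

lemma dotProduct_eq_zero_of_disjoint {D B : Finset (Fin p)} (h : Disjoint D B) {u v : Fin p → ℝ}
    (hu : u ∈ coordSubspace D) (hv : v ∈ coordSubspace B) : u ⬝ᵥ v = 0 := by
  refine Finset.sum_eq_zero fun i _ => ?_
  by_cases hi : i ∈ D
  · rw [hv i (Finset.disjoint_left.1 h hi), mul_zero]
  · rw [hu i hi, zero_mul]

lemma dotProduct_mulVec_le_specNorm_padded (M : Matrix (Fin p) (Fin p) ℝ) {B : Finset (Fin p)}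
    {v : Fin p → ℝ} (hv : v ∈ coordSubspace B) :
    v ⬝ᵥ M *ᵥ v ≤ specNorm (padded M B) * (v ⬝ᵥ v) := by
  have h1 := dotProduct_padded_sub_one_mulVec M B v v
  rw [restrictTo_of_mem hv, sub_mulVec, sub_mulVec, dotProduct_sub, dotProduct_sub] at h1
  have h2 := le_of_abs_le (abs_dotProduct_mulVec_le (padded M B) v v)
  rw [mul_assoc, Real.mul_self_sqrt (real_dotProduct_self_nonneg v)] at h2
  linarith

/-- `1 ≤ c` accounts for the ones on the padded diagonal. -/
lemma specNorm_padded_le {M : Matrix (Fin p) (Fin p) ℝ} (hM : M.IsSymm) {B : Finset (Fin p)}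
    {c : ℝ} (hc : 1 ≤ c) (h0 : ∀ v ∈ coordSubspace B, 0 ≤ v ⬝ᵥ M *ᵥ v)
    (h : ∀ v ∈ coordSubspace B, v ⬝ᵥ M *ᵥ v ≤ c * (v ⬝ᵥ v)) : specNorm (padded M B) ≤ c := by
  have hsymm : (padded M B).IsSymm := by
    rw [padded_eq, IsSymm]
    simp only [transpose_add, transpose_mul, transpose_sub, diagonal_transpose, transpose_one,
      hM.eq, Matrix.mul_assoc]
  have h0c : 0 ≤ c := by linarith
  have hq : ∀ v : Fin p → ℝ, |v ⬝ᵥ padded M B *ᵥ v| ≤ c * (v ⬝ᵥ (1 : Matrix _ _ ℝ) *ᵥ v) := by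
    intro v
    have h1 := dotProduct_padded_sub_one_mulVec M B v v
    have h2 := h _ (restrictTo_mem B v)
    have h3 := h0 _ (restrictTo_mem B v)
    have h4 := restrictTo_dotProduct_self_le B v
    simp only [sub_mulVec, dotProduct_sub, one_mulVec] at h1 ⊢
    rw [abs_le]
    have h5 := real_dotProduct_self_nonneg (restrictTo B v)
    constructor <;> nlinarith
  refine specNorm_le h0c fun u v => ?_
  have := abs_dotProduct_mulVec_le_of_quadraticForm hsymm (isSymm_one) ⊤
    (fun v _ => by rw [one_mulVec]; exact real_dotProduct_self_nonneg v) (fun v _ => hq v)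
    (Submodule.mem_top : u ∈ ⊤) (Submodule.mem_top : v ∈ ⊤) h0c
  simpa only [one_mulVec] using this

end Restriction

/-! ### Quadratic form and rank of a spiked covariance -/

section Spiked

variable {p r : ℕ} {V : Matrix (Fin p) (Fin r) ℝ} {ℓ : Fin r → ℝ} {S : Matrix (Fin p) (Fin p) ℝ}

lemma IsSpiked.dotProduct_mulVec (h : IsSpiked V ℓ S) (u v : Fin p → ℝ) :
    u ⬝ᵥ S *ᵥ v = ∑ i, ℓ i * (Vᵀ *ᵥ u) i * (Vᵀ *ᵥ v) i + u ⬝ᵥ v := by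
  rw [h.eq, add_mulVec, dotProduct_add, one_mulVec, ← mulVec_mulVec, ← mulVec_mulVec,
    Matrix.dotProduct_mulVec, ← mulVec_transpose]
  congr 1
  refine Finset.sum_congr rfl fun i _ => ?_
  rw [mulVec_diagonal]
  ring

lemma IsSpiked.isSymm (h : IsSpiked V ℓ S) : S.IsSymm := by
  rw [h.eq, IsSymm]
  simp [Matrix.mul_assoc]

lemma IsSpiked.dotProduct_self_le (h : IsSpiked V ℓ S) (v : Fin p → ℝ) :
    v ⬝ᵥ v ≤ v ⬝ᵥ S *ᵥ v := by
  rw [h.dotProduct_mulVec]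
  have : 0 ≤ ∑ i, ℓ i * (Vᵀ *ᵥ v) i * (Vᵀ *ᵥ v) i := Finset.sum_nonneg fun i _ => by
    rw [mul_assoc]
    exact mul_nonneg (h.pos i).le (mul_self_nonneg _)
  linarith

lemma IsSpiked.posDef (h : IsSpiked V ℓ S) : S.PosDef := by
  refine PosDef.of_dotProduct_mulVec_pos (by simpa [IsHermitian, IsSymm] using h.isSymm.eq)
    fun v hv => ?_
  simp only [star_trivial]
  exact (real_dotProduct_self_pos hv).trans_le (h.dotProduct_self_le v)

lemma IsSpiked.norm_transpose_mulVec_le (h : IsSpiked V ℓ S) (v : Fin p → ℝ) :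
    (Vᵀ *ᵥ v) ⬝ᵥ (Vᵀ *ᵥ v) ≤ v ⬝ᵥ v := by
  have h0 := real_dotProduct_self_nonneg (v - V *ᵥ (Vᵀ *ᵥ v))
  have h1 : (V *ᵥ (Vᵀ *ᵥ v)) ⬝ᵥ (V *ᵥ (Vᵀ *ᵥ v)) = (Vᵀ *ᵥ v) ⬝ᵥ (Vᵀ *ᵥ v) := by
    rw [Matrix.dotProduct_mulVec, ← mulVec_transpose, mulVec_mulVec, h.orthonormal, one_mulVec]
  have h2 : v ⬝ᵥ (V *ᵥ (Vᵀ *ᵥ v)) = (Vᵀ *ᵥ v) ⬝ᵥ (Vᵀ *ᵥ v) := by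
    rw [Matrix.dotProduct_mulVec, ← mulVec_transpose]
  rw [sub_dotProduct, dotProduct_sub, dotProduct_sub, h1, h2, dotProduct_comm (V *ᵥ (Vᵀ *ᵥ v)) v, h2] at h0
  linarith

lemma IsSpiked.dotProduct_mulVec_le (h : IsSpiked V ℓ S) {lam : ℝ} (hl : ∀ i, ℓ i ≤ lam)
    (hlam : 0 ≤ lam) (v : Fin p → ℝ) : v ⬝ᵥ S *ᵥ v ≤ (1 + lam) * (v ⬝ᵥ v) := by
  rw [h.dotProduct_mulVec]
  have h1 : ∑ i, ℓ i * (Vᵀ *ᵥ v) i * (Vᵀ *ᵥ v) i ≤ lam * ((Vᵀ *ᵥ v) ⬝ᵥ (Vᵀ *ᵥ v)) := by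
    rw [dotProduct, Finset.mul_sum]
    refine Finset.sum_le_sum fun i _ => ?_
    rw [mul_assoc]
    exact mul_le_mul_of_nonneg_right (hl i) (mul_self_nonneg _)
  have h2 := mul_le_mul_of_nonneg_left (h.norm_transpose_mulVec_le v) hlam
  linarith

lemma IsSpiked.mulVec_dotProduct_self (h : IsSpiked V ℓ S) (a : Fin r → ℝ) :
    (V *ᵥ a) ⬝ᵥ (V *ᵥ a) = a ⬝ᵥ a := by
  rw [Matrix.dotProduct_mulVec, ← mulVec_transpose, mulVec_mulVec, h.orthonormal, one_mulVec]

lemma IsSpiked.le_dotProduct_mulVec (h : IsSpiked V ℓ S) {c : ℝ} (hl : ∀ i, c ≤ ℓ i)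
    (a : Fin r → ℝ) : (1 + c) * (a ⬝ᵥ a) ≤ (V *ᵥ a) ⬝ᵥ S *ᵥ (V *ᵥ a) := by
  rw [h.dotProduct_mulVec, h.mulVec_dotProduct_self, mulVec_mulVec, h.orthonormal, one_mulVec,
    add_mul, one_mul, add_comm, dotProduct, Finset.mul_sum]
  refine add_le_add (Finset.sum_le_sum fun i _ => ?_) le_rfl
  rw [mul_assoc]
  exact mul_le_mul_of_nonneg_right (hl i) (mul_self_nonneg _)

lemma transpose_mulVec_eq_zero {D : Finset (Fin p)} (hD : ∀ i ∈ D, i ∉ rowSupport V)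
    {v : Fin p → ℝ} (hv : v ∈ coordSubspace D) : Vᵀ *ᵥ v = 0 := by
  ext i
  change ∑ j, V j i * v j = 0
  refine Finset.sum_eq_zero fun j _ => ?_
  by_cases hj : j ∈ D
  · have h1 : V.row j = 0 := by simpa [rowSupport] using hD j hj
    have h2 : V j i = 0 := congrFun h1 i
    simp [h2]
  · rw [hv j hj, mul_zero]

lemma mulVec_mem_coordSubspace {A : Finset (Fin p)} (hA : rowSupport V ⊆ A) (a : Fin r → ℝ) :
    V *ᵥ a ∈ coordSubspace A := by
  intro j hj
  have h1 : V.row j = 0 := by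
    by_contra h
    exact hj (hA h)
  change ∑ i, V j i * a i = 0
  refine Finset.sum_eq_zero fun i _ => ?_
  have h2 : V j i = 0 := congrFun h1 i
  rw [h2, zero_mul]

/-- The number of spikes depends on `S` alone, so any two spiked representations agree on it. -/
lemma IsSpiked.rank_sub_one (h : IsSpiked V ℓ S) : (S - 1).rank = r := by
  have h1 : S - 1 = V * diagonal ℓ * Vᵀ := by rw [h.eq, add_sub_cancel_right]
  have h2 : Vᵀ * (S - 1) * V = diagonal ℓ := by
    calc Vᵀ * (S - 1) * V = (Vᵀ * V) * diagonal ℓ * (Vᵀ * V) := by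
          rw [h1]; simp only [Matrix.mul_assoc]
      _ = _ := by rw [h.orthonormal]; simp
  have h3 : (diagonal ℓ).rank = r := by
    rw [rank_diagonal]
    simp [(h.pos _).ne']
  apply le_antisymm
  · rw [h1]
    exact (rank_mul_le_right _ _).trans ((rank_le_height _).trans (by simp))
  · rw [← h3, ← h2]
    exact (rank_mul_le_left _ _).trans (rank_mul_le_right _ _)

lemma IsSpiked.rank_diagonal (h : IsSpiked V ℓ S) : (diagonal ℓ).rank = r := by
  rw [Matrix.rank_diagonal]
  simp [(h.pos _).ne']

end Spiked
end SparseSpiked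

namespace SparseSpiked

open Matrix

/-! ### Deterministic analysis on the good event -/

section GoodEvent

/-- The sample covariance matrix is close to `S` as a quadratic form on `ℝ^A`, on `ℝ^D` and on
`ℝ^(A ∪ D)` for all small `D` disjoint from `A`. -/
structure GoodEvent {n p : ℕ} (S : Matrix (Fin p) (Fin p) ℝ) (A : Finset (Fin p)) (k : ℕ) (γ : ℝ)
    (X : Data n p) : Prop where
  core : ∀ v ∈ coordSubspace A,
    |v ⬝ᵥ sampleCov X *ᵥ v - v ⬝ᵥ S *ᵥ v| ≤ eta k n p γ * (v ⬝ᵥ S *ᵥ v)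
  outer : ∀ D ⊆ Aᶜ, D.card ≤ k → ∀ v ∈ coordSubspace D,
    |v ⬝ᵥ sampleCov X *ᵥ v - v ⬝ᵥ S *ᵥ v| ≤ eta D.card n p γ * (v ⬝ᵥ S *ᵥ v)
  union : ∀ D ⊆ Aᶜ, D.card ≤ k → ∀ v ∈ coordSubspace (A ∪ D),
    |v ⬝ᵥ sampleCov X *ᵥ v - v ⬝ᵥ S *ᵥ v| ≤ 9 / 5 * eta k n p γ * (v ⬝ᵥ S *ᵥ v)

variable {n p r k : ℕ} {V : Matrix (Fin p) (Fin r) ℝ} {ℓ : Fin r → ℝ}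
  {S : Matrix (Fin p) (Fin p) ℝ} {A B : Finset (Fin p)} {γ : ℝ} {X : Data n p}

lemma sampleCov_quadraticForm_nonneg (X : Data n p) (v : Fin p → ℝ) :
    0 ≤ v ⬝ᵥ sampleCov X *ᵥ v := by
  rw [dotProduct_sampleCov_mulVec]
  exact mul_nonneg (by positivity) (Finset.sum_nonneg fun t _ => mul_self_nonneg _)

lemma GoodEvent.specNorm_padded_sub_one_le (hS : IsSpiked V ℓ S) (hA : rowSupport V ⊆ A)
    (h : GoodEvent S A k γ X) {D : Finset (Fin p)} (hD : D ⊆ Aᶜ) (hDk : D.card ≤ k) :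
    specNorm (padded (sampleCov X) D - 1) ≤ eta D.card n p γ := by
  have hV : ∀ i ∈ D, i ∉ rowSupport V := fun i hi hiV =>
    (Finset.mem_compl.1 (hD hi)) (hA hiV)
  have hη := eta_nonneg D.card n p γ
  refine specNorm_le hη fun u v => ?_
  rw [dotProduct_padded_sub_one_mulVec]
  have hq : ∀ w ∈ coordSubspace D, |w ⬝ᵥ (sampleCov X - 1) *ᵥ w| ≤
      eta D.card n p γ * (w ⬝ᵥ (1 : Matrix _ _ ℝ) *ᵥ w) := by
    intro w hw
    have h1 := h.outer D hD hDk w hw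
    have h2 : w ⬝ᵥ S *ᵥ w = w ⬝ᵥ w := by
      rw [hS.dotProduct_mulVec, transpose_mulVec_eq_zero hV hw]; simp
    rw [h2] at h1
    simpa only [sub_mulVec, dotProduct_sub, one_mulVec] using h1
  have h3 := abs_dotProduct_mulVec_le_of_quadraticForm ((sampleCov_isSymm X).sub isSymm_one)
    isSymm_one (coordSubspace D)
    (fun w _ => by rw [one_mulVec]; exact real_dotProduct_self_nonneg w) hq
    (restrictTo_mem D u) (restrictTo_mem D v) hη
  simp only [one_mulVec] at h3
  refine h3.trans ?_
  gcongr <;> exact restrictTo_dotProduct_self_le _ _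

/-- For `x` on `D` and `y` on `A` one has `xᵀSy = 0`, so `xᵀŜy` is pure deviation, at most `9/5 η
‖x‖ √(yᵀSy)`. Replacing `yᵀSy` by `yᵀŜy` costs a factor `1/(1 - η)`, absorbed since `(9/5)² /
(19/20) ≤ 4`. -/
lemma GoodEvent.specNorm_block_le (hS : IsSpiked V ℓ S) (hA : rowSupport V ⊆ A)
    (h : GoodEvent S A k γ X) (hη : eta k n p γ ≤ 1 / 20) {D : Finset (Fin p)} (hD : D ⊆ Aᶜ)
    (hDk : D.card ≤ k) :
    specNorm (block (sampleCov X) D A) ≤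
      2 * √(specNorm (padded (sampleCov X) A)) * eta k n p γ := by
  have hV : ∀ i ∈ D, i ∉ rowSupport V := fun i hi hiV =>
    (Finset.mem_compl.1 (hD hi)) (hA hiV)
  have hdisj : Disjoint D A := Finset.disjoint_left.2 fun i hi => Finset.mem_compl.1 (hD hi)
  have hη0 := eta_nonneg k n p γ
  refine specNorm_le (by positivity) fun u w => ?_
  rw [dotProduct_block_mulVec, ← extendZero_dotProduct_self D u, ← extendZero_dotProduct_self A w]
  set x := extendZero D u
  set y := extendZero A w
  have hx : x ∈ coordSubspace D := extendZero_mem D u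
  have hy : y ∈ coordSubspace A := extendZero_mem A w
  have hVx : Vᵀ *ᵥ x = 0 := transpose_mulVec_eq_zero hV hx
  have hxx : x ⬝ᵥ S *ᵥ x = x ⬝ᵥ x := by rw [hS.dotProduct_mulVec, hVx]; simp
  have hxy : x ⬝ᵥ S *ᵥ y = 0 := by
    rw [hS.dotProduct_mulVec, hVx, dotProduct_eq_zero_of_disjoint hdisj hx hy]; simp
  have h3 := abs_dotProduct_mulVec_le_of_quadraticForm ((sampleCov_isSymm X).sub hS.isSymm)
    hS.isSymm (coordSubspace (A ∪ D))
    (fun v _ => (real_dotProduct_self_nonneg v).trans (hS.dotProduct_self_le v))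
    (fun v hv => by
      have := h.union D hD hDk v hv
      simpa only [sub_mulVec, dotProduct_sub] using this)
    (coordSubspace_mono Finset.subset_union_right hx)
    (coordSubspace_mono Finset.subset_union_left hy) (by positivity)
  rw [sub_mulVec, dotProduct_sub, hxy, sub_zero, hxx] at h3
  have h4 := (abs_le.1 (h.core y hy)).1
  have h5 := dotProduct_mulVec_le_specNorm_padded (sampleCov X) hy
  have h6 := (real_dotProduct_self_nonneg y).trans (hS.dotProduct_self_le y)
  have h7 : 9 / 5 * √(y ⬝ᵥ S *ᵥ y) ≤
      2 * (√(specNorm (padded (sampleCov X) A)) * √(y ⬝ᵥ y)) := by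
    rw [← Real.sqrt_mul (specNorm_nonneg _)]
    refine le_of_sq_le_sq ?_ (by positivity)
    rw [mul_pow, mul_pow, Real.sq_sqrt h6, Real.sq_sqrt
      (mul_nonneg (specNorm_nonneg _) (real_dotProduct_self_nonneg y))]
    nlinarith
  calc _ ≤ _ := h3
    _ = eta k n p γ * √(x ⬝ᵥ x) * (9 / 5 * √(y ⬝ᵥ S *ᵥ y)) := by ring
    _ ≤ eta k n p γ * √(x ⬝ᵥ x) *
        (2 * (√(specNorm (padded (sampleCov X) A)) * √(y ⬝ᵥ y))) := by gcongr
    _ = _ := by ring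

lemma GoodEvent.mem_suppSets (hS : IsSpiked V ℓ S) (hA : rowSupport V ⊆ A) (hAk : A.card = k)
    (h : GoodEvent S A k γ X) (hη : eta k n p γ ≤ 1 / 20) : A ∈ suppSets k γ X :=
  ⟨hAk, fun _ hD hDk => ⟨h.specNorm_padded_sub_one_le hS hA hD hDk,
    h.specNorm_block_le hS hA hη hD hDk⟩⟩

lemma GoodEvent.abs_sub_le_of_card (h : GoodEvent S A k γ X) (hB : B.card = k) {v : Fin p → ℝ}
    (hv : v ∈ coordSubspace B) :
    |v ⬝ᵥ sampleCov X *ᵥ v - v ⬝ᵥ S *ᵥ v| ≤ 9 / 5 * eta k n p γ * (v ⬝ᵥ S *ᵥ v) := by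
  -- Any `B` of size `k` lies in `A ∪ D` for the admissible choice `D = B \ A`.
  refine h.union (B \ A) (fun i hi => ?_) ?_ v (coordSubspace_mono (fun i hi => ?_) hv)
  · exact Finset.mem_compl.2 (Finset.mem_sdiff.1 hi).2
  · rw [← hB]
    exact Finset.card_le_card Finset.sdiff_subset
  · rw [Finset.union_sdiff_self_eq_union]
    exact Finset.mem_union_right _ hi

lemma GoodEvent.singVal_succ_le (hS : IsSpiked V ℓ S) (h : GoodEvent S A k γ X)
    (hB : B.card = k) :
    singVal (block (sampleCov X) B B) (r + 1) ≤ 1 + 9 / 5 * eta k n p γ := by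
  have hη0 := eta_nonneg k n p γ
  refine singVal_le ?_ (fun v => ?_) (by positivity) (Vᵀ.mulVecLin ∘ₗ extendZero B) fun v hv => ?_
  · exact (sampleCov_isSymm X).submatrix _
  · rw [dotProduct_block_mulVec]
    exact sampleCov_quadraticForm_nonneg X _
  · have hVv : Vᵀ *ᵥ extendZero B v = 0 := hv
    have h1 := (abs_le.1 (h.abs_sub_le_of_card hB (extendZero_mem B v))).2
    rw [hS.dotProduct_mulVec, hVv] at h1
    rw [dotProduct_block_mulVec, ← extendZero_dotProduct_self]
    simp only [Pi.zero_apply, mul_zero, Finset.sum_const_zero, zero_add] at h1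
    linarith

/-- A coordinate outside `B` contributes a padded diagonal entry `1`. If there is none then `A = B =
[p]`, and a diagonal entry of the sample covariance is at least `1 - η`. -/
lemma GoodEvent.specNorm_padded_ge (hS : IsSpiked V ℓ S) (hAk : A.card = k) (hk : 1 ≤ k)
    (h : GoodEvent S A k γ X) (hη : eta k n p γ ≤ 1 / 20) (hB : B.card = k) :
    1 / 4 ≤ specNorm (padded (sampleCov X) B) := by
  by_cases hBu : ∃ j, j ∉ B
  · obtain ⟨j, hj⟩ := hBu
    have h1 := dotProduct_padded_sub_one_mulVec (sampleCov X) B (Pi.single j 1) (Pi.single j 1)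
    have h0 : restrictTo B (Pi.single j (1 : ℝ)) = 0 := by
      ext i
      by_cases hi : i ∈ B
      · have : i ≠ j := fun e => hj (e ▸ hi)
        simp [restrictTo, this]
      · simp [restrictTo, hi]
    have h2 := le_of_abs_le (abs_dotProduct_mulVec_le (padded (sampleCov X) B) (Pi.single j 1)
      (Pi.single j 1))
    rw [h0, zero_dotProduct, sub_mulVec, dotProduct_sub, one_mulVec, single_one_dotProduct,
      single_one_dotProduct, Pi.single_eq_same] at h1
    rw [single_one_dotProduct, single_one_dotProduct, Pi.single_eq_same, Real.sqrt_one] at h2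
    linarith
  · push Not at hBu
    have hBuniv : B = Finset.univ := Finset.eq_univ_iff_forall.2 hBu
    have hAuniv : A = Finset.univ := by
      rw [← Finset.card_eq_iff_eq_univ, hAk, ← hB, hBuniv, Finset.card_univ]
    have hne : A.Nonempty := Finset.card_pos.1 (by omega)
    obtain ⟨j, _⟩ := hne
    have hmem : ∀ F : Finset (Fin p), F = Finset.univ →
        (Pi.single j 1 : Fin p → ℝ) ∈ coordSubspace F := by
      rintro F rfl i hi
      exact absurd (Finset.mem_univ i) hi
    have h1 := (abs_le.1 (h.core _ (hmem A hAuniv))).1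
    have h2 := dotProduct_mulVec_le_specNorm_padded (sampleCov X) (hmem B hBuniv)
    have h3 := hS.dotProduct_self_le (Pi.single j 1)
    have h4 : (Pi.single j 1 : Fin p → ℝ) ⬝ᵥ Pi.single j 1 = 1 := by simp
    rw [h4] at h2 h3
    nlinarith

lemma GoodEvent.specNorm_padded_le (hS : IsSpiked V ℓ S) {lam : ℝ} (hl : ∀ i, ℓ i ≤ lam)
    (hlam : 0 ≤ lam) (h : GoodEvent S A k γ X) (hη : eta k n p γ ≤ 1 / 20) (hB : B.card = k) :
    specNorm (padded (sampleCov X) B) ≤ 2 * (1 + lam) := by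
  refine SparseSpiked.specNorm_padded_le (sampleCov_isSymm X) (by linarith)
    (fun v _ => sampleCov_quadraticForm_nonneg X v) fun v hv => ?_
  have h1 := (abs_le.1 (h.abs_sub_le_of_card hB hv)).2
  have h2 := hS.dotProduct_mulVec_le hl hlam v
  have h3 := (real_dotProduct_self_nonneg v).trans (hS.dotProduct_self_le v)
  nlinarith

lemma GoodEvent.le_singVal (hS : IsSpiked V ℓ S) (hA : rowSupport V ⊆ A) (hAk : A.card = k)
    (hkp : k ≤ p) (hγ : 10 ≤ γ) (hr : 1 ≤ r) {c t : ℝ} (hl : ∀ i, c ≤ ℓ i)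
    (h : GoodEvent S A k γ X) (hη : eta k n p γ ≤ 1 / 20) (hB : B ∈ suppSets k γ X)
    (ht : 1 + eta k n p γ < t)
    (htc : t + 2 * √(specNorm (padded (sampleCov X) B)) * eta k n p γ ≤
      (1 - eta k n p γ) * (1 + c)) :
    t ≤ singVal (block (sampleCov X) B B) r := by
  have hη0 := eta_nonneg k n p γ
  set η := eta k n p γ with hηdef
  set N := specNorm (padded (sampleCov X) B)
  have hDcard : (A \ B).card ≤ k := by
    rw [← hAk]; exact Finset.card_le_card Finset.sdiff_subset
  obtain ⟨hB1, hB2⟩ := hB.2 (A \ B)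
    (fun i hi => Finset.mem_compl.2 (Finset.mem_sdiff.1 hi).2) hDcard
  have hB1' := hB1.trans (eta_mono hDcard hkp hγ)
  -- With `V a = x + y`, subtract the cross term and the `y` term from `vᵀŜv ≥ (1 - η)(1 + c)(‖x‖² +
  -- ‖y‖²)`; the tests passed by `B` bound both.
  have key : ∀ a : Fin r → ℝ,
      t * (restrictTo B (V *ᵥ a) ⬝ᵥ restrictTo B (V *ᵥ a)) +
        (t - 1 - η) * (restrictTo (A \ B) (V *ᵥ a) ⬝ᵥ restrictTo (A \ B) (V *ᵥ a)) ≤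
      restrictTo B (V *ᵥ a) ⬝ᵥ sampleCov X *ᵥ restrictTo B (V *ᵥ a) := by
    intro a
    have hv := mulVec_mem_coordSubspace hA a
    have hsum := restrictTo_add_sdiff B hv
    have h1 := (abs_le.1 (h.core _ hv)).1
    have h2 := hS.le_dotProduct_mulVec hl a
    have h3 := hS.mulVec_dotProduct_self a
    have hx := restrictTo_mem B (V *ᵥ a)
    have hy := restrictTo_mem (A \ B) (V *ᵥ a)
    set v := V *ᵥ a
    set x := restrictTo B v
    set y := restrictTo (A \ B) v
    have hyx : y ⬝ᵥ x = 0 := dotProduct_eq_zero_of_disjoint Finset.sdiff_disjoint hy hx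
    have e1 : v ⬝ᵥ v = x ⬝ᵥ x + y ⬝ᵥ y := by
      rw [← hsum, add_dotProduct, dotProduct_add, dotProduct_add, hyx, dotProduct_comm x y, hyx]
      ring
    have e2 : v ⬝ᵥ sampleCov X *ᵥ v = x ⬝ᵥ sampleCov X *ᵥ x + 2 * (y ⬝ᵥ sampleCov X *ᵥ x) +
        y ⬝ᵥ sampleCov X *ᵥ y := by
      rw [← hsum, mulVec_add, add_dotProduct, dotProduct_add, dotProduct_add,
        dotProduct_sampleCov_comm X x y]
      ring
    have h4 : y ⬝ᵥ sampleCov X *ᵥ x ≤ 2 * √N * η * √(y ⬝ᵥ y) * √(x ⬝ᵥ x) := by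
      have g := le_of_abs_le (abs_dotProduct_mulVec_le (block (sampleCov X) (A \ B) B)
        (fun i => y i) (fun i => x i))
      rw [dotProduct_block_mulVec, ← extendZero_dotProduct_self, ← extendZero_dotProduct_self,
        extendZero_coe hx, extendZero_coe hy] at g
      refine g.trans ?_
      gcongr
    have h5 : y ⬝ᵥ sampleCov X *ᵥ y ≤ (1 + η) * (y ⬝ᵥ y) := by
      have g := le_of_abs_le (abs_dotProduct_mulVec_le (padded (sampleCov X) (A \ B) - 1) y y)
      rw [dotProduct_padded_sub_one_mulVec, restrictTo_of_mem hy, mul_assoc,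
        Real.mul_self_sqrt (real_dotProduct_self_nonneg y), sub_mulVec, dotProduct_sub,
        one_mulVec] at g
      nlinarith [mul_le_mul_of_nonneg_right hB1' (real_dotProduct_self_nonneg y)]
    have hx0 := real_dotProduct_self_nonneg x
    have hy0 := real_dotProduct_self_nonneg y
    have h6 : 2 * (√(y ⬝ᵥ y) * √(x ⬝ᵥ x)) ≤ y ⬝ᵥ y + x ⬝ᵥ x := by
      have := two_mul_le_add_sq (√(y ⬝ᵥ y)) (√(x ⬝ᵥ x))
      rw [Real.sq_sqrt hx0, Real.sq_sqrt hy0] at this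
      linarith
    have h7 : 0 ≤ 2 * √N * η := by positivity
    have h8 : 2 * (y ⬝ᵥ sampleCov X *ᵥ x) ≤ 2 * √N * η * (y ⬝ᵥ y + x ⬝ᵥ x) := by
      have := mul_le_mul_of_nonneg_left h6 h7
      linarith
    have h9 : (1 - η) * ((1 + c) * (a ⬝ᵥ a)) ≤ v ⬝ᵥ sampleCov X *ᵥ v := by
      have := mul_le_mul_of_nonneg_left h2 (by linarith : 0 ≤ 1 - η)
      linarith
    have h10 := mul_le_mul_of_nonneg_right htc (add_nonneg hx0 hy0)
    rw [← h3, e1] at h9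
    rw [e2] at h9
    linarith
  have hext : ∀ a : Fin r → ℝ, extendZero B (fun i => (V *ᵥ a) i) = restrictTo B (V *ᵥ a) := by
    intro a
    ext i
    by_cases hi : i ∈ B <;> simp [extendZero, restrictTo, hi]
  refine SparseSpiked.le_singVal hr (by linarith)
    -- The test space is the column space of `V` restricted to `B`. It keeps dimension `r` because
    -- `t > 1 + η` forbids a nonzero `V a` supported in `A \ B`.
    (LinearMap.funLeft ℝ ℝ (Subtype.val : B → Fin p) ∘ₗ V.mulVecLin) ?_ fun a => ?_
  · rw [← LinearMap.ker_eq_bot, LinearMap.ker_eq_bot']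
    intro a ha
    have hx : restrictTo B (V *ᵥ a) = 0 := by
      rw [← hext]
      exact (congrArg (extendZero B) ha).trans (map_zero _)
    have h1 := key a
    rw [hx, zero_dotProduct, zero_dotProduct, mul_zero, zero_add] at h1
    have hy : restrictTo (A \ B) (V *ᵥ a) = 0 := by
      by_contra hne
      have := mul_pos (by linarith : 0 < t - 1 - η) (real_dotProduct_self_pos hne)
      linarith
    have hv : V *ᵥ a = 0 := by
      rw [← restrictTo_add_sdiff B (mulVec_mem_coordSubspace hA a), hx, hy, add_zero]
    have h2 := hS.mulVec_dotProduct_self a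
    rw [hv, zero_dotProduct] at h2
    exact dotProduct_self_eq_zero.1 h2.symm
  · rw [dotProduct_block_mulVec, ← extendZero_dotProduct_self]
    have e : extendZero B ((LinearMap.funLeft ℝ ℝ (Subtype.val : B → Fin p) ∘ₗ V.mulVecLin) a) =
        restrictTo B (V *ᵥ a) := hext a
    rw [e]
    have := mul_nonneg (by linarith : 0 ≤ t - 1 - η)
      (real_dotProduct_self_nonneg (restrictTo (A \ B) (V *ᵥ a)))
    linarith [key a]

/-- On the good event the rank estimator equals the number of spikes. -/
lemma GoodEvent.rankEst_eq (hS : IsSpiked V ℓ S) (hA : rowSupport V ⊆ A) (hAk : A.card = k)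
    (hk : 1 ≤ k) (hkp : k ≤ p) (hrk : r ≤ k) (hn : 1 ≤ n) (hγ : 10 ≤ γ) {c lam γ₂ : ℝ}
    (hc : ∀ i, c ≤ ℓ i) (hl : ∀ i, ℓ i ≤ lam) (hlam : 0 ≤ lam) (hγ₂ : 34 ≤ γ₂)
    (h : GoodEvent S A k γ X) (hη : eta k n p γ ≤ 1 / 20)
    (hsep : ∀ N, 0 ≤ N → N ≤ 2 * (1 + lam) →
      1 + (γ₂ + 2) * √N * eta k n p γ ≤ (1 - eta k n p γ) * (1 + c))
    {sel : Data n p → Finset (Fin p)} (hsel : IsSelection k γ sel) :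
    rankEst k γ γ₂ sel X = r := by
  have hne : (suppSets k γ X).Nonempty := ⟨A, h.mem_suppSets hS hA hAk hη⟩
  have hB := hsel X hne
  unfold rankEst
  rw [if_pos hne]
  have hη0 : 0 < eta k n p γ := eta_pos hn hk
  have hN1 := h.specNorm_padded_ge hS hAk hk hη hB.1
  have hN2 := h.specNorm_padded_le hS hl hlam hη hB.1
  have hsq : 1 / 2 ≤ √(specNorm (padded (sampleCov X) (sel X))) :=
    Real.le_sqrt_of_sq_le (by linarith)
  -- `34 * 1/2 = 17`, which exceeds both the `9/5` of the upper bound and the `1` required of `t`.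
  have hgap : 17 * eta k n p γ ≤
      γ₂ * √(specNorm (padded (sampleCov X) (sel X))) * eta k n p γ := by
    have : 17 ≤ γ₂ * √(specNorm (padded (sampleCov X) (sel X))) := by nlinarith
    exact mul_le_mul_of_nonneg_right this hη0.le
  apply le_antisymm
  · refine Finset.sup_le fun l hl' => ?_
    by_contra! hlt
    have h1 := (Finset.mem_filter.1 hl').2
    have h2 := singVal_antitone (block (sampleCov X) (sel X) (sel X))
      (show r + 1 ≤ l from hlt)
    have h3 := h.singVal_succ_le hS hB.1
    linarith
  · rcases Nat.eq_zero_or_pos r with hr | hr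
    · omega
    · refine Finset.le_sup (f := id) (Finset.mem_filter.2 ⟨Finset.mem_Icc.2 ⟨hr, hrk⟩, ?_⟩)
      refine h.le_singVal hS hA hAk hkp hγ hr hc hη hB (by linarith) ?_
      have := hsep _ (specNorm_nonneg _) hN2
      linarith

end GoodEvent
end SparseSpiked

namespace SparseSpiked

open MeasureTheory

/-! ### Probability of the good event -/

section Probability

variable {n p r k : ℕ} {V : Matrix (Fin p) (Fin r) ℝ} {ℓ : Fin r → ℝ}
  {S : Matrix (Fin p) (Fin p) ℝ} {A : Finset (Fin p)} {γ : ℝ}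

lemma exp_neg_subsetEntropy_le (hk : 1 ≤ k) (hkp : k ≤ p) (hγ : 10 ≤ γ) :
    Real.exp (-(γ / 2 * subsetEntropy k p)) ≤ (p : ℝ) ^ (1 - γ / 2) := by
  have hp : (1 : ℝ) ≤ p := by exact_mod_cast hk.trans hkp
  have h1 := log_add_half_le_subsetEntropy hk hkp
  have h2 : (0 : ℝ) ≤ k := by positivity
  have h3 := Real.log_nonneg hp
  rw [Real.rpow_def_of_pos (by linarith)]
  apply Real.exp_le_exp.2
  have h4 : γ / 2 * Real.log p ≤ γ / 2 * subsetEntropy k p := by gcongr; linarith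
  linarith

lemma dataLaw_real_not_goodEvent_le (hS : IsSpiked V ℓ S) (hAk : A.card = k) (hn : 1 ≤ n)
    (hk : 1 ≤ k) (hkp : k ≤ p) (hγ : 10 ≤ γ) (hη : eta k n p γ ≤ 1 / 20) :
    (dataLaw n S).real {X | ¬ GoodEvent S A k γ X} ≤ 3 * (p : ℝ) ^ (1 - γ / 2) := by
  have hη0 : 0 < eta k n p γ := eta_pos hn hk
  let bad : Finset (Fin p) → ℝ → Set (Data n p) := fun F δ => {X | ¬ ∀ v ∈ coordSubspace F,
    |v ⬝ᵥ (sampleCov X).mulVec v - v ⬝ᵥ S.mulVec v| ≤ δ * (v ⬝ᵥ S.mulVec v)}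
  -- The union runs over all nonempty small `D`, even those meeting `A`, so that it can be summed by
  -- cardinality. The empty `D` is trivial or covered by `core`.
  let badAt : Finset (Fin p) → Set (Data n p) := fun D =>
    if 1 ≤ D.card ∧ D.card ≤ k then
      bad D (eta D.card n p γ) ∪ bad (A ∪ D) (9 / 5 * eta k n p γ) else ∅
  have hsub : {X : Data n p | ¬ GoodEvent S A k γ X} ⊆ bad A (eta k n p γ) ∪
      ⋃ D ∈ (Finset.univ : Finset (Fin p)).powerset, badAt D := by
    intro X hX
    by_contra hcon
    simp only [Set.mem_union, Set.mem_iUnion, not_or, not_exists] at hcon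
    obtain ⟨hc1, hc2⟩ := hcon
    have hcore := not_not.1 hc1
    have hD : ∀ D : Finset (Fin p), 1 ≤ D.card → D.card ≤ k →
        X ∉ bad D (eta D.card n p γ) ∧ X ∉ bad (A ∪ D) (9 / 5 * eta k n p γ) := by
      intro D h1 h2
      have := hc2 D (Finset.mem_powerset.2 (Finset.subset_univ D))
      simp only [badAt, h1, h2, and_self, if_true, Set.mem_union, not_or] at this
      exact this
    refine hX ⟨hcore, fun D _ hDk v hv => ?_, fun D _ hDk v hv => ?_⟩
    · rcases Finset.eq_empty_or_nonempty D with rfl | hne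
      · have hv0 : v = 0 := funext fun i => hv i (Finset.notMem_empty i)
        subst hv0
        simp
      · exact not_not.1 (hD D (Finset.card_pos.2 hne) hDk).1 v hv
    · rcases Finset.eq_empty_or_nonempty D with rfl | hne
      · rw [Finset.union_empty] at hv
        refine (hcore v hv).trans ?_
        have := (real_dotProduct_self_nonneg v).trans (hS.dotProduct_self_le v)
        exact mul_le_mul_of_nonneg_right (by linarith) this
      · exact not_not.1 (hD D (Finset.card_pos.2 hne) hDk).2 v hv
  have hbadA : (dataLaw n S).real (bad A (eta k n p γ)) ≤
      Real.exp (-(γ / 2 * subsetEntropy k p)) := by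
    refine (dataLaw_real_coordSubspace hn hS.posDef A hη0 (by linarith)).trans ?_
    rw [hAk]
    exact tail_eta_le hn hk hkp hγ
  have hbadAt : ∀ D ∈ (Finset.univ : Finset (Fin p)).powerset, (dataLaw n S).real (badAt D) ≤
      2 * (if D.card = 0 then 0 else Real.exp (-(γ / 2 * subsetEntropy D.card p))) := by
    intro D _
    by_cases hD : 1 ≤ D.card ∧ D.card ≤ k
    · simp only [badAt, if_pos hD, if_neg (by omega : ¬ D.card = 0)]
      obtain ⟨hD1, hDk⟩ := hD
      have b1 : (dataLaw n S).real (bad D (eta D.card n p γ)) ≤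
          Real.exp (-(γ / 2 * subsetEntropy D.card p)) := by
        refine (dataLaw_real_coordSubspace hn hS.posDef D (eta_pos hn hD1) ?_).trans
          (tail_eta_le hn hD1 (hDk.trans hkp) hγ)
        linarith [eta_mono (n := n) hDk hkp hγ]
      have b2 : (dataLaw n S).real (bad (A ∪ D) (9 / 5 * eta k n p γ)) ≤
          Real.exp (-(γ / 2 * subsetEntropy D.card p)) := by
        have hcard : (A ∪ D).card ≤ 2 * k := (Finset.card_union_le A D).trans (by omega)
        refine (dataLaw_real_coordSubspace hn hS.posDef (A ∪ D) (by positivity)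
          (by linarith)).trans ((tail_eta_union_le hn hk hcard hkp hγ).trans ?_)
        apply Real.exp_le_exp.2
        have := mul_le_mul_of_nonneg_left (subsetEntropy_mono hDk hkp) (by linarith : 0 ≤ γ / 2)
        linarith
      linarith [measureReal_union_le (μ := dataLaw n S) (bad D (eta D.card n p γ))
        (bad (A ∪ D) (9 / 5 * eta k n p γ))]
    · simp only [badAt, if_neg hD, measureReal_empty]
      split_ifs <;> positivity
  calc _ ≤ _ := measureReal_mono hsub (measure_ne_top _ _)
    _ ≤ _ := measureReal_union_le _ _
    _ ≤ (p : ℝ) ^ (1 - γ / 2) + ∑ D ∈ (Finset.univ : Finset (Fin p)).powerset,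
        2 * (if D.card = 0 then 0 else Real.exp (-(γ / 2 * subsetEntropy D.card p))) :=
        add_le_add (hbadA.trans (exp_neg_subsetEntropy_le hk hkp hγ))
          ((measureReal_biUnion_finset_le _ _).trans (Finset.sum_le_sum hbadAt))
    _ ≤ _ := by
        rw [← Finset.mul_sum]
        linarith [sum_exp_neg_subsetEntropy_le (hk.trans hkp) hγ]

end Probability

/-! ### Signal strength -/

section Constants

/-- The signal strength condition turns into the eigenvalue separation used on the good event. -/
lemma separation_of_signal {η lam τ γ₂ G : ℝ} (hη0 : 0 ≤ η) (hη : η ≤ 1 / 20) (hτ : 1 ≤ τ)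
    (hγ₂ : 34 ≤ γ₂) (hG : G = 1 + 3 / 2 * (γ₂ + 2)) (hlam0 : 0 ≤ lam)
    (hlam : 16 * τ ^ 2 * G ^ 2 * η ≤ lam) {N : ℝ} (hN : N ≤ 2 * (1 + lam)) :
    1 + (γ₂ + 2) * √N * η ≤ (1 - η) * (1 + lam / τ) := by
  have hG1 : 1 ≤ G := by rw [hG]; linarith
  set s := √lam with hs
  have hs0 : 0 ≤ s := Real.sqrt_nonneg _
  have hs2 : s ^ 2 = lam := Real.sq_sqrt hlam0
  -- The threshold grows only like `√lam`, so both small and large `lam` are handled by one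
  -- condition linear in `η`.
  have hsqrt : √N ≤ 3 / 2 * (1 + s) := by
    refine Real.sqrt_le_left (by positivity) |>.2 (hN.trans ?_)
    rw [← hs2]
    nlinarith
  have hτG : 1 ≤ τ * G := one_le_mul_of_one_le_of_one_le hτ hG1
  have h1 : 4 * (τ * G) * η ≤ s := by
    refine le_of_sq_le_sq ?_ hs0
    rw [hs2]
    have : (4 * (τ * G) * η) ^ 2 = 16 * τ ^ 2 * G ^ 2 * η * η := by ring
    rw [this]
    nlinarith [mul_nonneg hlam0 hη0, mul_le_mul_of_nonneg_right hlam hη0]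
  have h2 : 4 * τ * (G * η * s) ≤ lam := by
    rw [← hs2]
    nlinarith [mul_le_mul_of_nonneg_right h1 hs0]
  have h3 : 4 * τ * (G * η) ≤ lam := by
    have h4 : 0 ≤ τ * G * η := by positivity
    have h5 : 16 * τ ^ 2 * G ^ 2 * η = 16 * (τ * G) * (τ * G * η) := by ring
    nlinarith [mul_le_mul_of_nonneg_right hτG h4]
  set c := lam / τ with hc
  have hτc : τ * c = lam := by rw [hc]; field_simp
  have h2' : 4 * (G * η * s) ≤ c := by
    rw [hc, le_div_iff₀ (by linarith)]; linarith
  have h3' : 4 * (G * η) ≤ c := by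
    rw [hc, le_div_iff₀ (by linarith)]; linarith
  have hc0 : 0 ≤ c := by positivity
  have h6 : (γ₂ + 2) * √N * η ≤ (γ₂ + 2) * (3 / 2 * (1 + s)) * η := by gcongr
  have h7 : (γ₂ + 2) * (3 / 2 * (1 + s)) * η = (G - 1) * η + (G - 1) * η * s := by
    rw [hG]; ring
  have h8 : 0 ≤ η * s := by positivity
  -- `(1 - η)(1 + c) - 1 = c - η - ηc`, and the three losses `Gη`, `Gηs`, `ηc` are at most `c/4`,
  -- `c/4`, `c/20`.
  nlinarith [mul_le_mul_of_nonneg_right hη hc0]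

end Constants
end SparseSpiked

/-! ### The main theorem -/

theorem theorem2 :
    ∃ C : ℝ, 0 < C ∧
      ∀ γ₁ : ℝ, 10 ≤ γ₁ →
        ∃ c₀ : ℝ, 0 < c₀ ∧ c₀ < 1 ∧
          ∀ γ₂ τ : ℝ, 8 * √γ₁ + 34 ≤ γ₂ → 1 ≤ τ →
            ∃ β : ℝ, 0 < β ∧
              ∀ (n p k : ℕ) (lam : ℝ), 1 ≤ n → 1 ≤ k → k ≤ p →
                τ * k / n * Real.log (Real.exp 1 * p / k) ≤ c₀ →
                β * √((k : ℝ) / n * Real.log (Real.exp 1 * p / k)) ≤ lam →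
                ∀ sel : SparseSpiked.Data n p → Finset (Fin p),
                  SparseSpiked.IsSelection k γ₁ sel →
                  (⨆ S ∈ SparseSpiked.Theta2 k p lam τ,
                    ⨆ (r : ℕ) (V : Matrix (Fin p) (Fin r) ℝ) (ℓ : Fin r → ℝ)
                      (_ : SparseSpiked.IsSpiked V ℓ S),
                      SparseSpiked.dataLaw n S
                        {X | SparseSpiked.rankEst k γ₁ γ₂ sel X ≠ (Matrix.diagonal ℓ).rank}) ≤
                    ENNReal.ofReal (C * (p : ℝ) ^ (1 - γ₁ / 2)) := by
  open SparseSpiked MeasureTheory in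
  refine ⟨3, by norm_num, fun γ₁ hγ₁ => ?_⟩
  set K := 1 + √γ₁ with hK
  have hK1 : 1 ≤ K := by rw [hK]; linarith [Real.sqrt_nonneg γ₁]
  -- This `c₀` forces `κ ≤ 1 / (1000 K)`, hence `η ≤ 3Kκ ≤ 3/1000`.
  refine ⟨(1 / (1000 * K)) ^ 2, by positivity, ?_, fun γ₂ τ hγ₂ hτ => ?_⟩
  · refine pow_lt_one₀ (by positivity) ?_ two_ne_zero
    rw [div_lt_one (by positivity)]
    linarith
  have hγ₂' : 34 ≤ γ₂ := by linarith [Real.sqrt_nonneg γ₁]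
  -- The factor `3K` converts `κ` into `η`; the rest is the constant of `separation_of_signal`.
  refine ⟨16 * τ ^ 2 * (1 + 3 / 2 * (γ₂ + 2)) ^ 2 * (3 * K), by positivity, ?_⟩
  intro n p k lam hn hk hkp hsmall hlam sel hsel
  set κ := √((k : ℝ) / n * Real.log (Real.exp 1 * p / k)) with hκ
  have hL := one_le_log_exp_one_mul_div hk hkp
  have hκ0 : 0 ≤ κ := Real.sqrt_nonneg _
  have hκ1 : κ ≤ 1 / (1000 * K) := by
    rw [hκ, Real.sqrt_le_left (by positivity)]
    refine le_trans ?_ hsmall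
    rw [mul_div_assoc τ, mul_assoc τ]
    exact le_mul_of_one_le_left (mul_nonneg (by positivity) (by linarith)) hτ
  have hKκ : K * κ ≤ 1 / 1000 := by
    calc K * κ ≤ K * (1 / (1000 * K)) := by gcongr
      _ = _ := by field_simp
  have hη1 : eta k n p γ₁ ≤ 3 * K * κ := eta_le hn hk hkp hγ₁ (by linarith)
  have hη : eta k n p γ₁ ≤ 1 / 20 := by linarith
  have hlam0 : 0 ≤ lam := le_trans (by positivity) hlam
  have hlam' : 16 * τ ^ 2 * (1 + 3 / 2 * (γ₂ + 2)) ^ 2 * eta k n p γ₁ ≤ lam := by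
    refine le_trans ?_ hlam
    rw [mul_assoc _ (3 * K) κ]
    gcongr
  refine iSup₂_le fun S hS => iSup₂_le fun r V => iSup₂_le fun ℓ hspk => ?_
  simp only [Theta2, Set.mem_iUnion, Finset.mem_range] at hS
  obtain ⟨r', hr', V', ℓ', hspk', hbd, hsupp⟩ := hS
  have hrank : (Matrix.diagonal ℓ).rank = r' := by
    rw [hspk.rank_diagonal, ← hspk.rank_sub_one, hspk'.rank_sub_one]
  obtain ⟨A, hA, hAk⟩ := Finset.exists_superset_card_eq
    (s := (Set.toFinite (rowSupport V')).toFinset) (n := k)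
    (by rwa [← Set.ncard_eq_toFinset_card]) (by simpa using hkp)
  have hA' : rowSupport V' ⊆ A := fun i hi => hA ((Set.Finite.mem_toFinset _).2 hi)
  calc dataLaw n S {X | rankEst k γ₁ γ₂ sel X ≠ (Matrix.diagonal ℓ).rank}
      -- The selection is arbitrary, so the error event need not be measurable; monotonicity of the
      -- outer measure suffices, and the bad event does not involve `sel`.
      ≤ dataLaw n S {X | ¬ GoodEvent S A k γ₁ X} := by
        refine measure_mono fun X hX hgood => hX ?_
        rw [hrank]
        exact hgood.rankEst_eq hspk' hA' hAk hk hkp (by omega) hn hγ₁ (fun i => (hbd i).1)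
          (fun i => (hbd i).2) hlam0 hγ₂' hη
          (fun N _ hN => separation_of_signal (eta_nonneg _ _ _ _) hη hτ hγ₂' rfl hlam0 hlam' hN)
          hsel
    _ = ENNReal.ofReal ((dataLaw n S).real {X | ¬ GoodEvent S A k γ₁ X}) :=
        (ofReal_measureReal (measure_ne_top _ _)).symm
    _ ≤ _ := ENNReal.ofReal_le_ofReal
        (dataLaw_real_not_goodEvent_le hspk' hAk hn hk hkp hγ₁ hη)
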